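/- For every constant $\beta\in(0,1]$ there are constants $\delta,\alpha>0$ and an integer $c\ge 1$, depending only on $\beta$, and an explicit family $(H_n)_{n\ge 0}$ of bipartite graphs $H_n=(L_n\cup R_n,E_n)$ such that the following holds. 1. For every $n$, $|L_n|\ge n$ and $|R_n|\le\beta|L_n|$, every vertex of $L_n$ has exactly $c$ neighbors, and $H_n$ is a $(\delta,\alpha)$-unique-neighbor expander: every non-empty $S\subseteq L_n$ with $|S|<\delta|L_n|$ has at least $\alpha c|S|$ unique neighbors, i.e. vertices of $R_n$ adjacent to exactly one vertex of $S$. Moreover $|R_n|\le\beta n$ for all sufficiently large $n$. 2. There are an integer $d$, a real $\delta'>0$, an integer $c'$, a fixed bipartite graph $G'$ with left side $\{1,\dots,d\}$ that is $c'$-left-regular and a $(\delta',\tfrac12)$-unique-neighbor expander, and an explicit family $(G_n)_{n\ge 0}$ of connected $d$-regular loopless graphs (parallel edges allowed) such that every eigenvalue of the adjacency matrix of $G_n$ other than $\pm d$ has absolute value at most $\tfrac{\delta'}{4}d$, and such that, up to a renaming of the right vertices, $H_n$ is a routed product $I(G_n)\circ G'$. Here $I(G)$ is the edge-vertex incidence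 graph of $G$: its left vertices are the edges of $G$, its right vertices are the vertices of $G$, and $e$ is adjacent to its two endpoints. Given an ordering of the $d$ edges at each vertex $v$ of $G$, the routed product $I(G)\circ G'$ has the edges of $G$ as left vertices and the pairs $(v,v')$, with $v$ a vertex of $G$ and $v'$ a right vertex of $G'$, as right vertices; $e$ is adjacent to $(v,v')$ if, for some $i$, $e$ is the $i$-th edge at $v$ and $i$ is adjacent to $v'$ in $G'$. A family of graphs is explicit if there is one algorithm that, on input $n$, outputs a complete description (numbers of vertices, list of edges) of the $n$-th graph in time polynomial in $n$. -/

import Mathlib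

/-! ### Bipartite graphs and unique-neighbor expansion -/

/-- A (simple) bipartite graph with left side `L` and right side `R`, given by the set
`Γ(u) = nbr u` of (right) neighbors of each left vertex `u`. The edges are the pairs
`(u, v)` with `v ∈ nbr u`. -/
structure BipartiteGraph (L R : Type) where
  nbr : L → Finset R

namespace BipartiteGraph

variable {L R : Type}

/-- Every left vertex has degree `c`. -/
def IsLeftRegular (G : BipartiteGraph L R) (c : ℕ) : Prop :=
  ∀ u, (G.nbr u).card = c

/-- `β`-unbalanced: `|R| ≤ β |L|`. -/
def IsUnbalanced [Fintype L] [Fintype R] (_G : BipartiteGraph L R) (β : ℝ) : Prop :=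
  (Fintype.card R : ℝ) ≤ β * Fintype.card L

open scoped Classical in
/-- The set of right vertices that are adjacent to exactly one vertex of `S`. -/
noncomputable def uniqueNbrs [Fintype R] (G : BipartiteGraph L R) (S : Finset L) : Finset R :=
  Finset.univ.filter fun v => ∃! u, u ∈ S ∧ v ∈ G.nbr u

/-- A `c`-left-regular bipartite graph is a `(δ, α)`-unique-neighbor expander if every nonempty
set `S` of left vertices with `|S| < δ |L|` has at least `α c |S|` unique neighbors. -/
def IsUNExpander [Fintype L] [Fintype R] (G : BipartiteGraph L R) (c : ℕ) (δ α : ℝ) : Prop :=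
  G.IsLeftRegular c ∧
    ∀ S : Finset L, S.Nonempty → (S.card : ℝ) < δ * Fintype.card L →
      α * c * S.card ≤ ((G.uniqueNbrs S).card : ℝ)

open scoped Classical in
/-- The routed product of an outer graph `G` on `L ∪ R` and an inner graph `G'` on `[d] ∪ R'`.
For each right vertex `v` of `G`, `ord v` is an ordering of the edges of `G` at `v` (named by
their left endpoints); `ord v i` is the `i`-th one. The left side of the product is `L`, the right
side is `R × R'`, and `u` is adjacent to `(v, v')` if, for some `i`, the edge `(u, v)` is the
`i`-th edge at `v` and `(i, v')` is an edge of `G'`. -/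
noncomputable def routedProduct {R' : Type} {d : ℕ} [Fintype R] [Fintype R']
    (G : BipartiteGraph L R) (ord : ∀ v : R, Fin d ≃ {u : L // v ∈ G.nbr u})
    (G' : BipartiteGraph (Fin d) R') : BipartiteGraph L (R × R') where
  nbr u := Finset.univ.filter fun p => ∃ i : Fin d, (ord p.1 i : L) = u ∧ p.2 ∈ G'.nbr i

/-- The list of numbers `out` describes the bipartite graph `G` on `{0,…,l-1} ∪ {0,…,r-1}`: it
consists of `l`, `r` and a list of all the edges, each given by its two endpoints. -/
def IsWrittenAs {l r : ℕ} (G : BipartiteGraph (Fin l) (Fin r)) (out : List ℕ) : Prop :=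
  ∃ es : List (Fin l × Fin r),
    (∀ u v, (u, v) ∈ es ↔ v ∈ G.nbr u) ∧
      out = l :: r :: es.flatMap fun e => [(e.1 : ℕ), (e.2 : ℕ)]

end BipartiteGraph

/-! ### Spectral expanders and edge-vertex incidence graphs -/

/-- A loopless undirected graph with vertex set `V` and edge set `E`, in which parallel edges are
allowed (as they occur in powers of graphs). -/
structure LooplessGraph (V E : Type) where
  ends : E → Sym2 V
  loopless : ∀ e, ¬ (ends e).IsDiag

namespace LooplessGraph

variable {V E : Type}

/-- Every vertex is incident to exactly `d` edges. -/
def IsRegular (G : LooplessGraph V E) (d : ℕ) : Prop :=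
  ∀ v, Nat.card {e : E // v ∈ G.ends e} = d

/-- The adjacency matrix: its `(u, v)` entry is the number of edges between `u` and `v`. -/
noncomputable def adjMatrix (G : LooplessGraph V E) : Matrix V V ℝ :=
  fun u v => (Nat.card {e : E // G.ends e = s(u, v)} : ℝ)

open scoped Classical in
/-- A `d`-regular graph is a `lam`-spectral expander if every eigenvalue of its adjacency matrix
other than `d` and `-d` has absolute value at most `lam`; here the top eigenvalue `d` is required
to be simple, that is, the graph is connected. -/
def IsSpectralExpander [Fintype V] (G : LooplessGraph V E) (d : ℕ) (lam : ℝ) : Prop :=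
  G.IsRegular d ∧
    Module.finrank ℝ (Module.End.eigenspace (Matrix.toLin' G.adjMatrix) (d : ℝ)) = 1 ∧
    ∀ μ : ℝ, Module.End.HasEigenvalue (Matrix.toLin' G.adjMatrix) μ →
      μ ≠ d → μ ≠ -d → |μ| ≤ lam

open scoped Classical in
/-- The edge-vertex incidence graph: left vertices are the edges, right vertices are the vertices,
and an edge is adjacent to its two endpoints. -/
noncomputable def incidenceGraph [Fintype V] (G : LooplessGraph V E) : BipartiteGraph E V where
  nbr e := Finset.univ.filter fun v => v ∈ G.ends e

/-- The list of numbers `out` describes the graph `G` with vertices `0,…,k-1` and edges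
`0,…,l-1`: it consists of `k`, `l` and the two endpoints of each edge, edge by edge. -/
def IsWrittenAs {k l : ℕ} (G : LooplessGraph (Fin k) (Fin l)) (out : List ℕ) : Prop :=
  ∃ es : Fin l → Fin k × Fin k,
    (∀ e, G.ends e = s((es e).1, (es e).2)) ∧
      out = k :: l :: (List.ofFn es).flatMap fun p => [(p.1 : ℕ), (p.2 : ℕ)]

end LooplessGraph

/-! ### Polynomial-time constructions

The machine model is the unit-cost random access machine with addition and (truncated)
subtraction, indirect addressing and an output tape, in the form of structured programs.
It has the same polynomial-time computations as Turing machines. -/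

/-- Programs of a random access machine with registers `r₀, r₁, …` holding natural numbers. -/
inductive RamProgram : Type
  /-- `rᵢ := k` -/
  | const (i k : ℕ)
  /-- `rᵢ := rⱼ` -/
  | copy (i j : ℕ)
  /-- `rᵢ := rⱼ + rₖ` -/
  | add (i j k : ℕ)
  /-- `rᵢ := max (rⱼ - rₖ) 0` -/
  | sub (i j k : ℕ)
  /-- `rᵢ := r_(rⱼ)` -/
  | load (i j : ℕ)
  /-- `r_(rᵢ) := rⱼ` -/
  | store (i j : ℕ)
  /-- append `rᵢ` to the output -/
  | print (i : ℕ)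
  /-- run `p`, then `q` -/
  | seq (p q : RamProgram)
  /-- if `rᵢ ≠ 0` run `p`, otherwise run `q` -/
  | ite (i : ℕ) (p q : RamProgram)
  /-- as long as `rᵢ ≠ 0`, run `p` -/
  | loop (i : ℕ) (p : RamProgram)

/-- A state of the machine: contents of the registers, and the output printed so far. -/
structure RamState where
  reg : ℕ → ℕ
  out : List ℕ

/-- The initial state on input `n`: `r₀ = n`, all other registers are `0`, nothing is printed. -/
def RamState.init (n : ℕ) : RamState where
  reg := Function.update (fun _ => 0) 0 n
  out := []

/-- The state after writing `x` into register `i`. -/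
def RamState.write (s : RamState) (i x : ℕ) : RamState where
  reg := Function.update s.reg i x
  out := s.out

/-- `RamRun p s t s'`: started in state `s`, the program `p` halts after exactly `t` steps, in
state `s'`. Each elementary instruction and each test of a register is one step. -/
inductive RamRun : RamProgram → RamState → ℕ → RamState → Prop
  | const (i k : ℕ) (s : RamState) : RamRun (.const i k) s 1 (s.write i k)
  | copy (i j : ℕ) (s : RamState) : RamRun (.copy i j) s 1 (s.write i (s.reg j))
  | add (i j k : ℕ) (s : RamState) : RamRun (.add i j k) s 1 (s.write i (s.reg j + s.reg k))
  | sub (i j k : ℕ) (s : RamState) : RamRun (.sub i j k) s 1 (s.write i (s.reg j - s.reg k))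
  | load (i j : ℕ) (s : RamState) : RamRun (.load i j) s 1 (s.write i (s.reg (s.reg j)))
  | store (i j : ℕ) (s : RamState) : RamRun (.store i j) s 1 (s.write (s.reg i) (s.reg j))
  | print (i : ℕ) (s : RamState) : RamRun (.print i) s 1 ⟨s.reg, s.out ++ [s.reg i]⟩
  | seq {p q : RamProgram} {s s₁ s₂ : RamState} {t₁ t₂ : ℕ}
      (h₁ : RamRun p s t₁ s₁) (h₂ : RamRun q s₁ t₂ s₂) : RamRun (.seq p q) s (t₁ + t₂) s₂
  | ite_true {i : ℕ} {p q : RamProgram} {s s₁ : RamState} {t : ℕ}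
      (hi : s.reg i ≠ 0) (h : RamRun p s t s₁) : RamRun (.ite i p q) s (t + 1) s₁
  | ite_false {i : ℕ} {p q : RamProgram} {s s₁ : RamState} {t : ℕ}
      (hi : s.reg i = 0) (h : RamRun q s t s₁) : RamRun (.ite i p q) s (t + 1) s₁
  | loop_done {i : ℕ} {p : RamProgram} {s : RamState}
      (hi : s.reg i = 0) : RamRun (.loop i p) s 1 s
  | loop_step {i : ℕ} {p : RamProgram} {s s₁ s₂ : RamState} {t₁ t₂ : ℕ}
      (hi : s.reg i ≠ 0) (h₁ : RamRun p s t₁ s₁) (h₂ : RamRun (.loop i p) s₁ t₂ s₂) :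
      RamRun (.loop i p) s (t₁ + t₂ + 1) s₂

/-- There is an explicit construction of objects `X n`, `n = 0, 1, 2, …`, where `IsCode n out`
says that the list of numbers `out` describes `X n`: one program prints, for each input `n`, a
description of `X n` in a number of steps polynomial in `n`. -/
def HasExplicitConstruction (IsCode : ℕ → List ℕ → Prop) : Prop :=
  ∃ (p : RamProgram) (T : Polynomial ℕ), ∀ n : ℕ, ∃ (t : ℕ) (s : RamState),
    RamRun p (RamState.init n) t s ∧ t ≤ T.eval n ∧ IsCode n s.out

/-! The outer graphs come from an elementary spectral gap on tori, the inner graph from counting,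
and a heavy/light argument for routed products combines them.

Spectral gap. Let the identity, two shears and two unit translations act on the torus of side m. On
the Fourier side the shears become inverse shears of the frequency, and the translations become
multiplications by characters. If a function of mean zero were nearly invariant under all of them,
the translations would push most of the weight of its transform into the box of frequencies with
coordinates below m/4 in absolute value. There the shears act as on pairs of integers and play
ping-pong: each of two sectors is carried by two shears (or by their inverses) into disjoint parts
of itself, so a nearly invariant weight that vanishes at the origin cannot concentrate in the box
(`sum_norm_sq_near_zero_le`). Hence some generator moves the function by a fixed proportion, and the
sum of the five generators contracts with a gap independent of m (`sum_sum_gen_sq_le`). Words of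
length t give d = 5^t permutations whose contraction factor, relative to d², decays exponentially in
t. The outer graph joins v on one side to each π i v on the other; contraction controls all its
eigenvalues other than ±d (`PermGraph.isSpectralExpander`).

Inner graph. A union bound yields 8-left-regular graphs in which every small S has at least 6|S|
neighbors, hence at least (2·6 - 8)|S| = 4|S| unique ones (`RandomGraph.exists_isUNExpander`).

Product. For a small set S of outer edges call a vertex heavy if it sees at least δ'd of them. There
are few heavy vertices, so by expander mixing few edges join two of them, and the light vertices see
at least (2/3)|S| edge ends. At each light vertex a copy of the inner graph supplies unique
neighbors, and copies at different vertices are disjoint (`PermGraph.product_isUNExpander`).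

Explicitness. The word length and the inner graph depend on β alone, so they are built into the
program as constants. At run time only the side length is searched for; the edges are then printed
using additions and subtractions, with multiples of the side length maintained alongside the
coordinates (`exists_run_graphProg`). -/

/-! ### The discrete Fourier transform on the torus `ZMod m × ZMod m` -/

namespace Torus

open Finset ZMod

variable {m : ℕ} [NeZero m]

/-- Fourier transform of a real function on the discrete torus. -/
noncomputable def fourier (f : ZMod m × ZMod m → ℝ) (w : ZMod m × ZMod m) : ℂ :=
  ∑ z : ZMod m × ZMod m, (f z : ℂ) * stdAddChar (-(w.1 * z.1 + w.2 * z.2))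

theorem fourier_sub (f g : ZMod m × ZMod m → ℝ) (w : ZMod m × ZMod m) :
    fourier (fun z => f z - g z) w = fourier f w - fourier g w := by
  simp only [fourier, ← sum_sub_distrib]
  refine sum_congr rfl fun z _ => ?_
  push_cast
  ring

theorem fourier_comp (f : ZMod m × ZMod m → ℝ) (σ : Equiv.Perm (ZMod m × ZMod m))
    (w : ZMod m × ZMod m) :
    fourier (fun z => f (σ z)) w =
      ∑ z, (f z : ℂ) * stdAddChar (-(w.1 * (σ.symm z).1 + w.2 * (σ.symm z).2)) := by
  rw [fourier, ← Equiv.sum_comp σ fun z => (f z : ℂ) *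
    stdAddChar (-(w.1 * (σ.symm z).1 + w.2 * (σ.symm z).2))]
  simp only [Equiv.symm_apply_apply]

theorem sum_stdAddChar (z : ZMod m × ZMod m) :
    ∑ w : ZMod m × ZMod m, (stdAddChar (w.1 * z.1 + w.2 * z.2) : ℂ) =
      if z = 0 then ((m : ℂ) ^ 2) else 0 := by
  have h := fun b : ZMod m => AddChar.sum_mulShift b (isPrimitive_stdAddChar m)
  simp only [Fintype.sum_prod_type, AddChar.map_add_eq_mul, ← mul_sum, ← sum_mul, h]
  rcases z with ⟨a, b⟩
  by_cases ha : a = 0 <;> by_cases hb : b = 0 <;> simp [ha, hb, sq]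

theorem conj_stdAddChar (a : ZMod m) :
    (starRingEnd ℂ) (stdAddChar a) = stdAddChar (-a) := by
  rw [AddChar.map_neg_eq_conj]

theorem sum_norm_fourier_sq (f : ZMod m × ZMod m → ℝ) :
    ∑ w, ‖fourier f w‖ ^ 2 = (m : ℝ) ^ 2 * ∑ z, f z ^ 2 := by
  have key : ∑ w, fourier f w * (starRingEnd ℂ) (fourier f w) =
      (m : ℂ) ^ 2 * ∑ z, (f z : ℂ) ^ 2 := by
    have h1 : ∀ w, fourier f w * (starRingEnd ℂ) (fourier f w) =
        ∑ z, ∑ z', (f z * f z' : ℂ) *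
          stdAddChar (w.1 * (z' - z).1 + w.2 * (z' - z).2) := by
      intro w
      simp only [fourier, map_sum, sum_mul_sum, map_mul, Complex.conj_ofReal, conj_stdAddChar]
      refine sum_congr rfl fun z _ => sum_congr rfl fun z' _ => ?_
      rw [mul_mul_mul_comm, ← AddChar.map_add_eq_mul]
      congr 2
      simp only [Prod.fst_sub, Prod.snd_sub]
      ring
    simp only [h1]
    rw [sum_comm, mul_sum]
    refine sum_congr rfl fun z _ => ?_
    rw [sum_comm]
    simp only [← mul_sum, sum_stdAddChar, sub_eq_zero]
    simp only [mul_ite, mul_zero, sum_ite_eq', mem_univ, if_true]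
    ring
  have h2 : ∀ w, ((‖fourier f w‖ ^ 2 : ℝ) : ℂ) = fourier f w * (starRingEnd ℂ) (fourier f w) := by
    intro w
    rw [Complex.mul_conj, Complex.normSq_eq_norm_sq]
  apply Complex.ofReal_injective
  push_cast at h2 ⊢
  simp only [h2, key]

theorem fourier_zero (f : ZMod m × ZMod m → ℝ) (hf : ∑ z, f z = 0) : fourier f 0 = 0 := by
  simp only [fourier, Prod.fst_zero, Prod.snd_zero, zero_mul, add_zero, neg_zero,
    AddChar.map_zero_eq_one, mul_one]
  exact_mod_cast hf

/-! ### Four permutations of the torus with a spectral gap -/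

/-- The identity, two shears and two translations of the torus. -/
def gen (m : ℕ) : Fin 5 → Equiv.Perm (ZMod m × ZMod m)
  | 0 => Equiv.refl _
  | 1 => ⟨fun z => (z.1 + z.2, z.2), fun z => (z.1 - z.2, z.2),
      fun z => by simp, fun z => by simp⟩
  | 2 => ⟨fun z => (z.1, z.1 + z.2), fun z => (z.1, z.2 - z.1),
      fun z => by simp, fun z => by simp⟩
  | 3 => ⟨fun z => (z.1 + 1, z.2), fun z => (z.1 - 1, z.2),
      fun z => by simp, fun z => by simp⟩
  | 4 => ⟨fun z => (z.1, z.2 + 1), fun z => (z.1, z.2 - 1),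
      fun z => by simp, fun z => by simp⟩

/-- Transposition exchanges the two shears σ and τ, so pairing w with σ⁻¹z is the same as pairing
τ⁻¹w with z. -/
theorem fourier_gen_one (f : ZMod m × ZMod m → ℝ) (w : ZMod m × ZMod m) :
    fourier (fun z => f (gen m 1 z)) w = fourier f ((gen m 2).symm w) := by
  rw [fourier_comp]
  refine sum_congr rfl fun z _ => ?_
  congr 2
  simp only [gen, Equiv.coe_fn_symm_mk]
  ring

theorem fourier_gen_two (f : ZMod m × ZMod m → ℝ) (w : ZMod m × ZMod m) :
    fourier (fun z => f (gen m 2 z)) w = fourier f ((gen m 1).symm w) := by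
  rw [fourier_comp]
  refine sum_congr rfl fun z _ => ?_
  congr 2
  simp only [gen, Equiv.coe_fn_symm_mk]
  ring

theorem fourier_gen_three (f : ZMod m × ZMod m → ℝ) (w : ZMod m × ZMod m) :
    fourier (fun z => f (gen m 3 z)) w = stdAddChar w.1 * fourier f w := by
  rw [fourier_comp, fourier, mul_sum]
  refine sum_congr rfl fun z _ => ?_
  rw [mul_left_comm, ← AddChar.map_add_eq_mul]
  congr 2
  simp only [gen, Equiv.coe_fn_symm_mk]
  ring

theorem fourier_gen_four (f : ZMod m × ZMod m → ℝ) (w : ZMod m × ZMod m) :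
    fourier (fun z => f (gen m 4 z)) w = stdAddChar w.2 * fourier f w := by
  rw [fourier_comp, fourier, mul_sum]
  refine sum_congr rfl fun z _ => ?_
  rw [mul_left_comm, ← AddChar.map_add_eq_mul]
  congr 2
  simp only [gen, Equiv.coe_fn_symm_mk]
  ring

/-- The squared distance of e^(iθ) from 1 is 2 - 2 cos θ, and here |θ| lies between π/2 and π, where
the cosine is not positive. -/
theorem two_le_norm_stdAddChar_sub_one_sq (a : ZMod m) (ha : (m : ℤ) ≤ 4 * |a.valMinAbs|) :
    2 ≤ ‖(stdAddChar a : ℂ) - 1‖ ^ 2 := by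
  have hm : (0 : ℝ) < m := by exact_mod_cast Nat.pos_of_ne_zero (NeZero.ne m)
  set j := a.valMinAbs with hj
  have h2 : 2 * |j| ≤ m := by
    have := valMinAbs_mem_Ioc a
    rw [Set.mem_Ioc] at this
    rw [← hj] at this
    have : |j * 2| ≤ m := abs_le.2 ⟨by omega, by omega⟩
    rw [abs_mul] at this
    simpa [mul_comm] using this
  have e : (stdAddChar a : ℂ) = Complex.exp (((2 * Real.pi * (j / m) : ℝ) : ℂ) * Complex.I) := by
    rw [← coe_valMinAbs a, stdAddChar_coe, ← hj]
    congr 1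
    push_cast
    ring
  have hr : Real.cos (2 * Real.pi * (j / m)) ≤ 0 := by
    rw [← Real.cos_abs]
    have h4 : |2 * Real.pi * ((j : ℝ) / m)| = 2 * Real.pi * (|(j : ℝ)| / m) := by
      rw [abs_mul, abs_div, abs_of_pos (by positivity : 0 < 2 * Real.pi), abs_of_pos hm]
    have ha' : (m : ℝ) ≤ 4 * |(j : ℝ)| := by exact_mod_cast ha
    have h2' : 2 * |(j : ℝ)| ≤ m := by exact_mod_cast h2
    have l1 : 1 / 4 ≤ |(j : ℝ)| / m := by rw [le_div_iff₀ hm]; linarith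
    have l2 : |(j : ℝ)| / m ≤ 1 / 2 := by rw [div_le_iff₀ hm]; linarith
    rw [h4]
    apply Real.cos_nonpos_of_pi_div_two_le_of_le <;> nlinarith [Real.pi_pos]
  rw [e, ← Complex.normSq_eq_norm_sq, Complex.normSq_apply]
  simp only [Complex.sub_re, Complex.sub_im, Complex.exp_ofReal_mul_I_re,
    Complex.exp_ofReal_mul_I_im, Complex.one_re, Complex.one_im]
  nlinarith [Real.sin_sq_add_cos_sq (2 * Real.pi * ((j : ℝ) / m))]

/-- If `φ ∘ σ` is close to `φ`, then the weight `|φ|²` of a set is at most about that of any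
set containing its image under `σ`. -/
theorem sum_norm_sq_le_of_mapsTo {V : Type*} [Fintype V] [DecidableEq V] (φ : V → ℂ)
    (σ : Equiv.Perm V) (C D : Finset V) (hCD : ∀ z ∈ C, σ z ∈ D)
    (h : ∑ z, ‖φ (σ z) - φ z‖ ^ 2 ≤ (∑ z, ‖φ z‖ ^ 2) / 400) :
    ∑ z ∈ C, ‖φ z‖ ^ 2 ≤ ∑ z ∈ D, ‖φ z‖ ^ 2 + (∑ z, ‖φ z‖ ^ 2) / 8 := by
  have h1 : ∑ z ∈ C, ‖φ (σ z)‖ ^ 2 ≤ ∑ z ∈ D, ‖φ z‖ ^ 2 := by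
    rw [← sum_image (f := fun z => ‖φ z‖ ^ 2) (g := σ) (fun x _ y _ hxy => σ.injective hxy)]
    refine sum_le_sum_of_subset_of_nonneg ?_ fun _ _ _ => by positivity
    exact image_subset_iff.2 hCD
  -- Factor the difference of squares and apply AM-GM. The weights are such that summation gives
  -- 10/400 + 2/20 = 1/8 of the total.
  have h2 : ∀ z, ‖φ z‖ ^ 2 - ‖φ (σ z)‖ ^ 2 ≤
      10 * ‖φ (σ z) - φ z‖ ^ 2 + (1 / 20) * (‖φ (σ z)‖ ^ 2 + ‖φ z‖ ^ 2) := by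
    intro z
    have t : ‖φ z‖ - ‖φ (σ z)‖ ≤ ‖φ (σ z) - φ z‖ := by
      rw [norm_sub_rev]; exact norm_sub_norm_le _ _
    nlinarith [norm_nonneg (φ z), norm_nonneg (φ (σ z)),
      sq_nonneg (20 * ‖φ (σ z) - φ z‖ - (‖φ (σ z)‖ + ‖φ z‖)),
      sq_nonneg (‖φ (σ z)‖ - ‖φ z‖),
      mul_le_mul_of_nonneg_right t (add_nonneg (norm_nonneg (φ z)) (norm_nonneg (φ (σ z))))]
  have h3 : ∑ z ∈ C, (‖φ z‖ ^ 2 - ‖φ (σ z)‖ ^ 2) ≤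
      ∑ z, (10 * ‖φ (σ z) - φ z‖ ^ 2 + (1 / 20) * (‖φ (σ z)‖ ^ 2 + ‖φ z‖ ^ 2)) :=
    (sum_le_sum fun z _ => h2 z).trans
      (sum_le_sum_of_subset_of_nonneg (subset_univ C) fun _ _ _ => by positivity)
  rw [sum_sub_distrib, sum_add_distrib, ← mul_sum, ← mul_sum, sum_add_distrib,
    Equiv.sum_comp σ fun z => ‖φ z‖ ^ 2] at h3
  linarith

/-- Inside the box of radius m/4 sums do not wrap around, so the shears can be analyzed on integer
representatives. -/
theorem valMinAbs_add_of_lt (a b : ZMod m) (ha : 4 * |a.valMinAbs| < m)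
    (hb : 4 * |b.valMinAbs| < m) : (a + b).valMinAbs = a.valMinAbs + b.valMinAbs := by
  rw [valMinAbs_spec]
  refine ⟨by simp, ?_, ?_⟩ <;>
  · have := neg_abs_le a.valMinAbs
    have := neg_abs_le b.valMinAbs
    have := le_abs_self a.valMinAbs
    have := le_abs_self b.valMinAbs
    linarith

theorem valMinAbs_sub_of_lt (a b : ZMod m) (ha : 4 * |a.valMinAbs| < m)
    (hb : 4 * |b.valMinAbs| < m) : (a - b).valMinAbs = a.valMinAbs - b.valMinAbs := by
  rw [valMinAbs_spec]
  refine ⟨by simp, ?_, ?_⟩ <;>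
  · have := neg_abs_le a.valMinAbs
    have := neg_abs_le b.valMinAbs
    have := le_abs_self a.valMinAbs
    have := le_abs_self b.valMinAbs
    linarith

/-- The integer points in the half-open first and third quadrants. -/
def Quad13 (x y : ℤ) : Prop := (0 < x ∧ 0 ≤ y) ∨ (x < 0 ∧ y ≤ 0)

/-- The integer points in the half-open second and fourth quadrants. -/
def Quad24 (x y : ℤ) : Prop := (x ≤ 0 ∧ 0 < y) ∨ (0 ≤ x ∧ y < 0)

open scoped Classical in
/-- No weight off the origin can be nearly invariant under both shears and concentrated near the
origin: the shears play ping-pong with two sectors. -/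
theorem sum_norm_sq_near_zero_le (φ : ZMod m × ZMod m → ℂ) (h0 : φ 0 = 0)
    (h1 : ∑ z, ‖φ ((gen m 1).symm z) - φ z‖ ^ 2 ≤ (∑ z, ‖φ z‖ ^ 2) / 400)
    (h2 : ∑ z, ‖φ ((gen m 2).symm z) - φ z‖ ^ 2 ≤ (∑ z, ‖φ z‖ ^ 2) / 400) :
    2 * ∑ z with 4 * |z.1.valMinAbs| < (m : ℤ) ∧ 4 * |z.2.valMinAbs| < (m : ℤ), ‖φ z‖ ^ 2 ≤
      (3 / 2) * ∑ z, ‖φ z‖ ^ 2 := by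
  have inv : ∀ σ : Equiv.Perm (ZMod m × ZMod m),
      ∑ z, ‖φ (σ z) - φ z‖ ^ 2 = ∑ z, ‖φ (σ.symm z) - φ z‖ ^ 2 := by
    intro σ
    rw [← Equiv.sum_comp σ.symm]
    simp [norm_sub_rev]
  set E := ∑ z, ‖φ z‖ ^ 2 with hE
  let B (Q : ℤ → ℤ → Prop) : Finset (ZMod m × ZMod m) := univ.filter fun z =>
    (4 * |z.1.valMinAbs| < (m : ℤ) ∧ 4 * |z.2.valMinAbs| < (m : ℤ)) ∧
      Q z.1.valMinAbs z.2.valMinAbs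
  let D (Q : ℤ → ℤ → Prop) : Finset (ZMod m × ZMod m) := univ.filter fun z =>
    Q z.1.valMinAbs z.2.valMinAbs
  -- Ping-pong: the shears carry the boxed part of the first sector into two disjoint parts of that
  -- sector, and the inverse shears do the same for the second. Adding the four bounds gives twice
  -- the box weight ≤ E + 4·E/8.
  have a1 := sum_norm_sq_le_of_mapsTo φ (gen m 1) (B Quad13)
    (D fun x y => Quad13 x y ∧ |y| < |x|) (by
      intro z hz
      simp only [B, D, mem_filter, mem_univ, true_and] at hz ⊢
      simp only [gen, Equiv.coe_fn_mk, valMinAbs_add_of_lt _ _ hz.1.1 hz.1.2]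
      unfold Quad13 at *
      grind) (by rw [inv]; exact h1)
  have a2 := sum_norm_sq_le_of_mapsTo φ (gen m 2) (B Quad13)
    (D fun x y => Quad13 x y ∧ ¬ |y| < |x|) (by
      intro z hz
      simp only [B, D, mem_filter, mem_univ, true_and] at hz ⊢
      simp only [gen, Equiv.coe_fn_mk, valMinAbs_add_of_lt _ _ hz.1.1 hz.1.2]
      unfold Quad13 at *
      grind) (by rw [inv]; exact h2)
  have a3 := sum_norm_sq_le_of_mapsTo φ (gen m 1).symm (B Quad24)
    (D fun x y => Quad24 x y ∧ ¬ |x| < |y|) (by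
      intro z hz
      simp only [B, D, mem_filter, mem_univ, true_and] at hz ⊢
      simp only [gen, Equiv.coe_fn_symm_mk, valMinAbs_sub_of_lt _ _ hz.1.1 hz.1.2]
      unfold Quad24 at *
      grind) h1
  have a4 := sum_norm_sq_le_of_mapsTo φ (gen m 2).symm (B Quad24)
    (D fun x y => Quad24 x y ∧ |x| < |y|) (by
      intro z hz
      simp only [B, D, mem_filter, mem_univ, true_and] at hz ⊢
      simp only [gen, Equiv.coe_fn_symm_mk, valMinAbs_sub_of_lt _ _ hz.1.2 hz.1.1]
      unfold Quad24 at *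
      grind) h2
  have split : ∀ Q R : ℤ → ℤ → Prop, ∑ z ∈ D (fun x y => Q x y ∧ R x y), ‖φ z‖ ^ 2 +
      ∑ z ∈ D (fun x y => Q x y ∧ ¬ R x y), ‖φ z‖ ^ 2 = ∑ z ∈ D Q, ‖φ z‖ ^ 2 := by
    intro Q R
    simp only [D, filter_and]
    rw [← sum_filter_add_sum_filter_not (univ.filter fun z : ZMod m × ZMod m =>
      Q z.1.valMinAbs z.2.valMinAbs) fun z => R z.1.valMinAbs z.2.valMinAbs]
    congr 2 <;> ext z <;> simp
  have s1 := split Quad13 fun x y => |y| < |x|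
  have s2 := split Quad24 fun x y => |x| < |y|
  have dis : ∀ x y : ℤ, Quad13 x y → ¬ Quad24 x y := by
    intro x y; unfold Quad13 Quad24; omega
  have cov : ∀ x y : ℤ, Quad13 x y ∨ Quad24 x y ∨ (x = 0 ∧ y = 0) := by
    intro x y; unfold Quad13 Quad24; omega
  have b1 : ∑ z ∈ D Quad13, ‖φ z‖ ^ 2 + ∑ z ∈ D Quad24, ‖φ z‖ ^ 2 ≤ E := by
    rw [← sum_union]
    · exact sum_le_sum_of_subset_of_nonneg (subset_univ _) fun _ _ _ => by positivity
    · rw [disjoint_left]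
      intro z hz hz'
      simp only [D, mem_filter, mem_univ, true_and] at hz hz'
      exact dis _ _ hz hz'
  have b2 : ∑ z with 4 * |z.1.valMinAbs| < (m : ℤ) ∧ 4 * |z.2.valMinAbs| < (m : ℤ), ‖φ z‖ ^ 2 ≤
      ∑ z ∈ B Quad13, ‖φ z‖ ^ 2 + ∑ z ∈ B Quad24, ‖φ z‖ ^ 2 := by
    rw [← sum_union]
    · rw [← sum_erase _ (f := fun z => ‖φ z‖ ^ 2) (a := 0) (by simp [h0])]
      refine sum_le_sum_of_subset_of_nonneg (fun z hz => ?_) fun _ _ _ => by positivity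
      simp only [B, mem_union, mem_erase, mem_filter, mem_univ, true_and] at hz ⊢
      obtain ⟨hne, hz⟩ := hz
      rcases cov z.1.valMinAbs z.2.valMinAbs with h | h | ⟨h, h'⟩
      · exact Or.inl ⟨hz, h⟩
      · exact Or.inr ⟨hz, h⟩
      · rw [valMinAbs_eq_zero] at h h'
        exact absurd (Prod.ext h h') hne
    · rw [disjoint_left]
      intro z hz hz'
      simp only [B, mem_filter, mem_univ, true_and] at hz hz'
      exact dis _ _ hz.2 hz'.2
  linarith

/-- Every function of mean zero on the torus is moved by a shear or by a translation. -/
theorem exists_gen_moves (f : ZMod m × ZMod m → ℝ) (hf : ∑ z, f z = 0) :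
    ∃ g : Fin 5, (∑ z, f z ^ 2) / 400 ≤ ∑ z, (f (gen m g z) - f z) ^ 2 := by
  classical
  by_contra! hcon
  have hm : (0 : ℝ) < m := by exact_mod_cast Nat.pos_of_ne_zero (NeZero.ne m)
  set E := ∑ w, ‖fourier f w‖ ^ 2 with hE
  have hEf : E = (m : ℝ) ^ 2 * ∑ z, f z ^ 2 := sum_norm_fourier_sq f
  have mv : ∀ g, ∑ w, ‖fourier (fun z => f (gen m g z)) w - fourier f w‖ ^ 2 < E / 400 := by
    intro g
    simp only [← fourier_sub]
    rw [sum_norm_fourier_sq, hEf, mul_div_assoc]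
    exact mul_lt_mul_of_pos_left (hcon g) (by positivity)
  have m1 := mv 1
  have m2 := mv 2
  have m3 := mv 3
  have m4 := mv 4
  simp only [fourier_gen_one, fourier_gen_two, fourier_gen_three, fourier_gen_four] at m1 m2 m3 m4
  have near := sum_norm_sq_near_zero_le (fourier f) (fourier_zero f hf) m2.le m1.le
  have far : ∀ c : ZMod m × ZMod m → ZMod m,
      ∑ w, ‖stdAddChar (c w) * fourier f w - fourier f w‖ ^ 2 < E / 400 →
      ∑ w with ¬ 4 * |(c w).valMinAbs| < (m : ℤ), ‖fourier f w‖ ^ 2 ≤ E / 800 := by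
    intro c hc
    have : ∑ w with ¬ 4 * |(c w).valMinAbs| < (m : ℤ), 2 * ‖fourier f w‖ ^ 2 ≤
        ∑ w, ‖stdAddChar (c w) * fourier f w - fourier f w‖ ^ 2 := by
      refine (sum_le_sum fun w hw => ?_).trans
        (sum_le_sum_of_subset_of_nonneg (filter_subset _ _) fun _ _ _ => by positivity)
      simp only [mem_filter, mem_univ, true_and, not_lt] at hw
      rw [← sub_one_mul, norm_mul, mul_pow]
      exact mul_le_mul_of_nonneg_right (two_le_norm_stdAddChar_sub_one_sq _ hw) (by positivity)
    rw [← mul_sum] at this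
    linarith
  have f1 := far (fun w => w.1) m3
  have f2 := far (fun w => w.2) m4
  have tot : E ≤ ∑ w with 4 * |w.1.valMinAbs| < (m : ℤ) ∧ 4 * |w.2.valMinAbs| < (m : ℤ),
      ‖fourier f w‖ ^ 2 + (∑ w with ¬ 4 * |w.1.valMinAbs| < (m : ℤ), ‖fourier f w‖ ^ 2 +
      ∑ w with ¬ 4 * |w.2.valMinAbs| < (m : ℤ), ‖fourier f w‖ ^ 2) := by
    rw [hE]
    simp only [sum_filter, ← sum_add_distrib]
    refine sum_le_sum fun w _ => ?_
    have : 0 ≤ ‖fourier f w‖ ^ 2 := by positivity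
    split_ifs <;> first | linarith | (exfalso; tauto)
  have hEpos : 0 ≤ E := sum_nonneg fun _ _ => by positivity
  -- The box carries at most 3E/4 and the rest at most 2·E/800, which contradicts E > 0. Positivity
  -- of E comes from the strict bound for the identity generator, so the zero function needs no
  -- separate case.
  linarith [mv 0, sum_nonneg fun (w : ZMod m × ZMod m) (_ : w ∈ univ) =>
    sq_nonneg ‖fourier (fun z => f (gen m 0 z)) w - fourier f w‖]

/-- The sum of the five generators contracts functions of mean zero. -/
theorem sum_sum_gen_sq_le (f : ZMod m × ZMod m → ℝ) (hf : ∑ z, f z = 0) :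
    ∑ z, (∑ g, f (gen m g z)) ^ 2 ≤ (25 - 1 / 400) * ∑ z, f z ^ 2 := by
  obtain ⟨g, hg⟩ := exists_gen_moves f hf
  -- The square of a sum of five terms is five times the sum of squares minus all squared pairwise
  -- differences. Since the identity is a generator, f z is one of the terms, so the displacement by
  -- `g` is one of these differences or zero.
  have pt : ∀ z, (∑ g, f (gen m g z)) ^ 2 ≤
      5 * ∑ g, f (gen m g z) ^ 2 - (f (gen m g z) - f z) ^ 2 := by
    intro z
    have h0 : f (gen m 0 z) = f z := rfl
    have key : ∀ a b c d e : ℝ, ∀ t, t ∈ [a, b, c, d, e] →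
        (a + b + c + d + e) ^ 2 ≤
          5 * (a ^ 2 + b ^ 2 + c ^ 2 + d ^ 2 + e ^ 2) - (t - a) ^ 2 := by
      intro a b c d e t ht
      simp only [List.mem_cons, List.not_mem_nil, or_false] at ht
      rcases ht with h | h | h | h | h <;> rw [h] <;>
      nlinarith [sq_nonneg (a - b), sq_nonneg (a - c), sq_nonneg (a - d), sq_nonneg (a - e),
        sq_nonneg (b - c), sq_nonneg (b - d), sq_nonneg (b - e), sq_nonneg (c - d),
        sq_nonneg (c - e), sq_nonneg (d - e)]
    rw [Fin.sum_univ_five, Fin.sum_univ_five, ← h0]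
    refine key _ _ _ _ _ _ ?_
    fin_cases g <;> simp
  refine (sum_le_sum fun z _ => pt z).trans ?_
  rw [sum_sub_distrib, ← mul_sum, sum_comm]
  have : ∀ g, ∑ z, f (gen m g z) ^ 2 = ∑ z, f z ^ 2 :=
    fun g => Equiv.sum_comp (gen m g) fun z => f z ^ 2
  simp only [this, sum_const, card_univ, Fintype.card_fin]
  norm_num
  linarith

end Torus

/-! ### Bipartite graphs of tuples of permutations -/

namespace PermGraph

open Finset

variable {N d : ℕ} (π : Fin d → Equiv.Perm (Fin N))

/-- The bipartite graph with sides `Fin N` and `Fin N` in which the edge `(v, i)` joins the left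
vertex `v` to the right vertex `π i v`. -/
def graph : LooplessGraph (Fin (N + N)) (Fin (N * d)) where
  ends e := s(Fin.castAdd N e.divNat, Fin.natAdd N (π e.modNat e.divNat))
  loopless e := by
    simp only [Sym2.mk_isDiag_iff, Fin.ext_iff, Fin.val_castAdd, Fin.val_natAdd]
    omega

theorem castAdd_ne_natAdd (v w : Fin N) : Fin.castAdd N v ≠ Fin.natAdd N w := by
  simp only [ne_eq, Fin.ext_iff, Fin.val_castAdd, Fin.val_natAdd]
  omega

/-- The left endpoint of the `i`-th edge at a vertex. -/
def src (p : Fin (N + N)) (i : Fin d) : Fin N :=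
  Fin.addCases (fun v => v) (fun w => (π i).symm w) p

/-- The other endpoint of the `i`-th edge at a vertex. -/
def opp (p : Fin (N + N)) (i : Fin d) : Fin (N + N) :=
  Fin.addCases (fun v => Fin.natAdd N (π i v)) (fun w => Fin.castAdd N ((π i).symm w)) p

theorem mem_ends_iff (p : Fin (N + N)) (e : Fin (N * d)) :
    p ∈ (graph π).ends e ↔ e.divNat = src π p e.modNat := by
  simp only [graph, Sym2.mem_iff, src]
  induction p using Fin.addCases with
  | left v => simp only [Fin.addCases_left, Fin.castAdd_inj, castAdd_ne_natAdd, or_false, eq_comm]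
  | right w =>
    simp only [Fin.addCases_right, Equiv.eq_symm_apply, Fin.natAdd_inj,
      (castAdd_ne_natAdd _ _).symm, false_or, eq_comm]

theorem ends_eq_iff (p q : Fin (N + N)) (e : Fin (N * d)) :
    (graph π).ends e = s(p, q) ↔ e.divNat = src π p e.modNat ∧ opp π p e.modNat = q := by
  simp only [graph, src, opp, Sym2.eq_iff]
  induction p using Fin.addCases with
  | left v =>
    simp only [Fin.addCases_left, Fin.castAdd_inj, (castAdd_ne_natAdd _ _).symm, and_false,
      or_false]
    constructor <;>
    · rintro ⟨rfl, rfl⟩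
      exact ⟨rfl, rfl⟩
  | right w =>
    simp only [Fin.addCases_right, Fin.natAdd_inj, castAdd_ne_natAdd, false_and, false_or]
    constructor
    · rintro ⟨rfl, rfl⟩
      simp
    · rintro ⟨h, rfl⟩
      rw [h]
      simp

/-- The edges at a vertex, in order. -/
def incEquiv (p : Fin (N + N)) : Fin d ≃ {e // p ∈ (graph π).ends e} where
  toFun i := ⟨finProdFinEquiv (src π p i, i), by
    rw [mem_ends_iff]
    have h := finProdFinEquiv.symm_apply_apply (src π p i, i)
    rw [finProdFinEquiv_symm_apply, Prod.mk.injEq] at h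
    rw [h.1, h.2]⟩
  invFun e := e.1.modNat
  left_inv i := by
    have h := finProdFinEquiv.symm_apply_apply (src π p i, i)
    rw [finProdFinEquiv_symm_apply, Prod.mk.injEq] at h
    exact h.2
  right_inv e := by
    apply Subtype.ext
    rw [← Equiv.eq_symm_apply, finProdFinEquiv_symm_apply, Prod.mk.injEq]
    exact ⟨((mem_ends_iff π p e.1).1 e.2).symm, rfl⟩

theorem isRegular : (graph π).IsRegular d := by
  intro p
  rw [← Nat.card_congr (incEquiv π p), Nat.card_fin]

theorem mem_incidenceGraph_nbr (p : Fin (N + N)) (e : Fin (N * d)) :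
    p ∈ (graph π).ends e ↔ p ∈ (graph π).incidenceGraph.nbr e := by
  simp [LooplessGraph.incidenceGraph]

/-- The edges at a vertex of the incidence graph, in order. -/
noncomputable def ord (p : Fin (N + N)) :
    Fin d ≃ {e // p ∈ (graph π).incidenceGraph.nbr e} :=
  (incEquiv π p).trans (Equiv.subtypeEquivRight fun e => mem_incidenceGraph_nbr π p e)

/-- The edge (v, i) has position i at both of its endpoints, because π i is a bijection. This makes
the routed product easy to describe: both ends use the same inner neighborhood. -/
theorem ord_eq_iff (p : Fin (N + N)) (i : Fin d) (e : Fin (N * d)) :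
    (ord π p i : Fin (N * d)) = e ↔ p ∈ (graph π).ends e ∧ e.modNat = i := by
  have h : (ord π p i : Fin (N * d)) = ((incEquiv π p) i : Fin (N * d)) := rfl
  rw [h]
  constructor
  · rintro rfl
    exact ⟨((incEquiv π p) i).2, (incEquiv π p).symm_apply_apply i⟩
  · rintro ⟨h1, rfl⟩
    exact congrArg Subtype.val ((incEquiv π p).apply_symm_apply ⟨e, h1⟩)

theorem adjMatrix_eq (p q : Fin (N + N)) :
    (graph π).adjMatrix p q = ∑ i, if opp π p i = q then (1 : ℝ) else 0 := by
  have e1 : {e // (graph π).ends e = s(p, q)} ≃ {i // opp π p i = q} :=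
    { toFun := fun e => ⟨e.1.modNat, ((ends_eq_iff π p q e.1).1 e.2).2⟩
      invFun := fun i => ⟨(incEquiv π p i.1).1, by
        rw [ends_eq_iff]
        have h : ((incEquiv π p i.1).1).modNat = i.1 := (incEquiv π p).symm_apply_apply i.1
        exact ⟨(mem_ends_iff π p _).1 (incEquiv π p i.1).2, by rw [h]; exact i.2⟩⟩
      left_inv := fun e => by
        apply Subtype.ext
        have he : p ∈ (graph π).ends e.1 := by rw [e.2]; simp
        exact (Subtype.ext_iff.1 ((incEquiv π p).apply_symm_apply ⟨e.1, he⟩) :)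
      right_inv := fun i => Subtype.ext ((incEquiv π p).symm_apply_apply i.1) }
  rw [LooplessGraph.adjMatrix, Nat.card_congr e1, Nat.card_eq_fintype_card, Fintype.card_subtype]
  simp

theorem adjMatrix_mulVec (φ : Fin (N + N) → ℝ) (p : Fin (N + N)) :
    ((graph π).adjMatrix.mulVec φ) p = ∑ i, φ (opp π p i) := by
  simp only [Matrix.mulVec, dotProduct, adjMatrix_eq, sum_mul, ite_mul, one_mul, zero_mul]
  rw [sum_comm]
  simp

/-- The sum of the permutations contracts functions of mean zero by the factor `κ` (in terms of
squared norms). -/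
def IsContracting (κ : ℝ) : Prop :=
  ∀ f : Fin N → ℝ, ∑ v, f v = 0 → ∑ v, (∑ i, f (π i v)) ^ 2 ≤ κ * ∑ v, f v ^ 2

variable {π}

/-- Here x and y are the two halves of an eigenvector. Evaluating the bilinear form of the edges in
two ways shows that x and y have equal norm; contraction applied to y then gives μ²‖x‖² ≤ κ‖y‖²,
impossible for κ < μ² unless both vanish. -/
theorem eigenvector_eq_zero {κ : ℝ} (hπ : IsContracting π κ) {x y : Fin N → ℝ} {μ : ℝ}
    (hx : ∀ v, ∑ i, y (π i v) = μ * x v) (hy : ∀ w, ∑ i, x ((π i).symm w) = μ * y w)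
    (h0 : ∑ w, y w = 0) (hμ : μ ≠ 0) (hκ : κ < μ ^ 2) : x = 0 ∧ y = 0 := by
  have h1 : μ * ∑ v, x v ^ 2 = μ * ∑ w, y w ^ 2 := by
    calc μ * ∑ v, x v ^ 2 = ∑ v, ∑ i, x v * y (π i v) := by
          rw [mul_sum]
          refine sum_congr rfl fun v _ => ?_
          rw [← mul_sum, hx]
          ring
      _ = ∑ i, ∑ w, x ((π i).symm w) * y w := by
          rw [sum_comm]
          refine sum_congr rfl fun i _ => ?_
          rw [← Equiv.sum_comp (π i) fun w => x ((π i).symm w) * y w]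
          simp only [Equiv.symm_apply_apply]
      _ = μ * ∑ w, y w ^ 2 := by
          rw [sum_comm]
          rw [mul_sum]
          refine sum_congr rfl fun w _ => ?_
          rw [← sum_mul, hy]
          ring
  have h2 := mul_left_cancel₀ hμ h1
  have h3 := hπ y h0
  simp only [hx, mul_pow, ← mul_sum] at h3
  rw [h2] at h3
  have h4 : 0 ≤ ∑ w, y w ^ 2 := sum_nonneg fun _ _ => sq_nonneg _
  have h5 : ∑ w, y w ^ 2 = 0 := by nlinarith
  have z : ∀ f : Fin N → ℝ, ∑ w, f w ^ 2 = 0 → f = 0 := by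
    intro f hf
    rw [sum_eq_zero_iff_of_nonneg fun _ _ => sq_nonneg _] at hf
    exact funext fun w => by simpa using hf w (mem_univ w)
  exact ⟨z x (h2.trans h5), z y h5⟩

theorem eigenvector_iff [DecidableEq (Fin (N + N))] (φ : Fin (N + N) → ℝ) (μ : ℝ) :
    Matrix.toLin' (graph π).adjMatrix φ = μ • φ ↔
      (∀ v, ∑ i, φ (Fin.natAdd N (π i v)) = μ * φ (Fin.castAdd N v)) ∧
      ∀ w, ∑ i, φ (Fin.castAdd N ((π i).symm w)) = μ * φ (Fin.natAdd N w) := by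
  rw [Matrix.toLin'_apply, funext_iff, Fin.forall_fin_add]
  simp only [adjMatrix_mulVec, opp, Pi.smul_apply, smul_eq_mul, Fin.addCases_left,
    Fin.addCases_right]

theorem eq_zero_of_sides {φ : Fin (N + N) → ℝ} (h : (fun v => φ (Fin.castAdd N v)) = 0)
    (h' : (fun v => φ (Fin.natAdd N v)) = 0) : φ = 0 := by
  funext p
  induction p using Fin.addCases with
  | left v => exact congrFun h v
  | right v => exact congrFun h' v

theorem finrank_eigenspace [NeZero N] [NeZero d] [DecidableEq (Fin (N + N))] {κ : ℝ}
    (hκ : κ < (d : ℝ) ^ 2) (hπ : IsContracting π κ) :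
    Module.finrank ℝ
      (Module.End.eigenspace (Matrix.toLin' (graph π).adjMatrix) (d : ℝ)) = 1 := by
  have hd : (d : ℝ) ≠ 0 := by exact_mod_cast NeZero.ne d
  have hN : (N : ℝ) ≠ 0 := by exact_mod_cast NeZero.ne N
  rw [finrank_eq_one_iff']
  have one_mem : (fun _ => 1 : Fin (N + N) → ℝ) ∈
      Module.End.eigenspace (Matrix.toLin' (graph π).adjMatrix) (d : ℝ) := by
    rw [Module.End.mem_eigenspace_iff, eigenvector_iff]
    simp
  refine ⟨⟨fun _ => 1, one_mem⟩, ?_, ?_⟩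
  · intro h
    have := congrFun (congrArg Subtype.val h) (Fin.castAdd N 0)
    simp at this
  · rintro ⟨φ, hφ⟩
    set c := (∑ w, φ (Fin.natAdd N w)) / N with hc
    refine ⟨c, Subtype.ext ?_⟩
    -- Subtracting the constant vector with the right-hand mean keeps the vector in the eigenspace
    -- and makes its right half have mean zero.
    have hmem := Submodule.sub_mem _ hφ (Submodule.smul_mem _ c one_mem)
    rw [Module.End.mem_eigenspace_iff, eigenvector_iff] at hmem
    have hz := eigenvector_eq_zero hπ
      (x := fun v => (φ - c • fun _ => 1 : Fin (N + N) → ℝ) (Fin.castAdd N v))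
      (y := fun w => (φ - c • fun _ => 1 : Fin (N + N) → ℝ) (Fin.natAdd N w)) hmem.1 hmem.2 (by
      simp only [Pi.sub_apply, Pi.smul_apply, smul_eq_mul, mul_one, sum_sub_distrib, sum_const,
        card_univ, Fintype.card_fin, nsmul_eq_mul, hc]
      rw [mul_div_cancel₀ _ hN, sub_self]) hd hκ
    exact (sub_eq_zero.1 (eq_zero_of_sides hz.1 hz.2)).symm

theorem abs_eigenvalue_le [DecidableEq (Fin (N + N))] {lam : ℝ} (h0 : 0 ≤ lam)
    (hπ : IsContracting π (lam ^ 2)) {μ : ℝ}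
    (hμ : Module.End.HasEigenvalue (Matrix.toLin' (graph π).adjMatrix) μ) (h1 : μ ≠ d)
    (h2 : μ ≠ -d) : |μ| ≤ lam := by
  obtain ⟨φ, hφ⟩ := hμ.exists_hasEigenvector
  have heq := hφ.apply_eq_smul
  rw [eigenvector_iff] at heq
  by_contra! hlt
  have hμ0 : μ ≠ 0 := by
    rintro rfl
    rw [abs_zero] at hlt
    linarith
  have sums : ∀ (f : Fin N → ℝ) (σ : Fin d → Equiv.Perm (Fin N)),
      ∑ v, ∑ i, f (σ i v) = d * ∑ v, f v := by
    intro f σ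
    rw [sum_comm]
    simp [Equiv.sum_comp (σ _) f]
  have s1 := sums (fun w => φ (Fin.natAdd N w)) π
  have s2 := sums (fun w => φ (Fin.castAdd N w)) fun i => (π i).symm
  simp only [heq.1, heq.2, ← mul_sum] at s1 s2
  -- Summing the eigenvector equations over each side gives dY = μX and dX = μY for the sums X, Y of
  -- the halves, so (d² - μ²)Y = 0.
  have s0 : ∑ w, φ (Fin.natAdd N w) = 0 := by
    have : ((d : ℝ) - μ) * (d + μ) * ∑ w, φ (Fin.natAdd N w) = 0 := by
      linear_combination (-d : ℝ) * s1 - μ * s2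
    rcases mul_eq_zero.1 this with h | h
    · rcases mul_eq_zero.1 h with h | h
      · exact absurd (by linarith) h1
      · exact absurd (by linarith) h2
    · exact h
  have hz := eigenvector_eq_zero hπ heq.1 heq.2 s0 hμ0 (by
    rw [← sq_abs μ]
    nlinarith)
  exact hφ.2 (eq_zero_of_sides hz.1 hz.2)

theorem isSpectralExpander [NeZero N] [NeZero d] {lam : ℝ} (h0 : 0 ≤ lam) (hlam : lam < d)
    (hπ : IsContracting π (lam ^ 2)) : (graph π).IsSpectralExpander d lam :=
  ⟨isRegular π, finrank_eigenspace (by nlinarith) hπ,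
    fun _ hμ h1 h2 => abs_eigenvalue_le h0 hπ hμ h1 h2⟩

end PermGraph

/-! ### Powers of the torus graph -/

namespace Torus

open Finset

/-- The words of length `t` in the five generators. -/
def words : ℕ → List (List (Fin 5))
  | 0 => [[]]
  | t + 1 => (words t).flatMap fun w => (List.finRange 5).map fun g => g :: w

theorem length_words (t : ℕ) : (words t).length = 5 ^ t := by
  induction t with
  | zero => rfl
  | succ t ih => simp [words, List.length_flatMap, ih, pow_succ]

/-- The permutation of the torus that applies the generators in a word one after the other. -/
def walk (m : ℕ) : List (Fin 5) → Equiv.Perm (ZMod m × ZMod m)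
  | [] => Equiv.refl _
  | g :: w => (gen m g).trans (walk m w)

variable {m : ℕ}

/-- The first letter of a word acts first, so lengthening the words applies the one-step operator to
the previous word sum. That sum again has mean zero, which lets the contraction be iterated. -/
theorem sum_words_succ (t : ℕ) (f : ZMod m × ZMod m → ℝ) (z : ZMod m × ZMod m) :
    ((words (t + 1)).map fun w => f (walk m w z)).sum =
      ∑ g, ((words t).map fun w => f (walk m w (gen m g z))).sum := by
  simp only [words]
  induction words t with
  | nil => simp
  | cons w l ih =>
    simp only [List.flatMap_cons, List.map_append, List.sum_append, ih, List.map_cons,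
      List.sum_cons, sum_add_distrib, List.map_map]
    congr 1

variable [NeZero m]

theorem sum_sum_words (t : ℕ) (f : ZMod m × ZMod m → ℝ) (hf : ∑ z, f z = 0) :
    ∑ z, ((words t).map fun w => f (walk m w z)).sum = 0 := by
  induction words t with
  | nil => simp
  | cons w l ih => simp [sum_add_distrib, ih, Equiv.sum_comp (walk m w) f, hf]

theorem sum_sum_words_sq_le (t : ℕ) (f : ZMod m × ZMod m → ℝ) (hf : ∑ z, f z = 0) :
    ∑ z, ((words t).map fun w => f (walk m w z)).sum ^ 2 ≤
      (25 - 1 / 400) ^ t * ∑ z, f z ^ 2 := by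
  induction t with
  | zero => simp [words, walk]
  | succ t ih =>
    simp only [sum_words_succ]
    refine (sum_sum_gen_sq_le _ (sum_sum_words t f hf)).trans ?_
    rw [pow_succ', mul_assoc]
    exact mul_le_mul_of_nonneg_left ih (by norm_num)

/-- The vertices of the torus, numbered row by row. -/
def index (k : ℕ) : ZMod (k + 1) × ZMod (k + 1) ≃ Fin ((k + 1) * (k + 1)) :=
  (finProdFinEquiv : Fin (k + 1) × Fin (k + 1) ≃ Fin ((k + 1) * (k + 1)))

/-- The permutations of the numbered torus given by the words of length `t`. -/
def wordPerm (k t : ℕ) (i : Fin (words t).length) : Equiv.Perm (Fin ((k + 1) * (k + 1))) :=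
  (index k).symm.trans ((walk (k + 1) (words t)[i]).trans (index k))

theorem isContracting_wordPerm (k t : ℕ) :
    PermGraph.IsContracting (wordPerm k t) ((25 - 1 / 400) ^ t) := by
  intro f hf
  have h := sum_sum_words_sq_le t (fun z => f (index k z)) (by
    rw [← hf, Equiv.sum_comp (index k) f])
  rw [← Equiv.sum_comp (index k) (fun v => f v ^ 2), ← Equiv.sum_comp (index k)]
  refine le_trans (le_of_eq (sum_congr rfl fun z _ => ?_)) h
  congr 1
  simp only [wordPerm, Equiv.trans_apply, Equiv.symm_apply_apply]
  rw [← List.sum_ofFn]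
  congr 1
  exact List.ext_getElem (by simp) (by simp)

end Torus

/-! ### Existence of constant-size unique-neighbor expanders -/

namespace BipartiteGraph

open Finset

/-- Count edges leaving S by their right ends: a neighbor that is not unique receives at least two
of them, and a unique one receives one and is counted once more on its own. -/
theorem two_mul_card_biUnion_le {L R : Type} [Fintype R] [DecidableEq R]
    (G : BipartiteGraph L R) {c : ℕ} (hG : G.IsLeftRegular c) (S : Finset L) :
    2 * (S.biUnion G.nbr).card ≤ (G.uniqueNbrs S).card + c * S.card := by
  classical
  have h1 : ∑ v ∈ S.biUnion G.nbr, (S.filter fun u => v ∈ G.nbr u).card = c * S.card := by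
    have h := sum_card_bipartiteAbove_eq_sum_card_bipartiteBelow (s := S)
      (t := S.biUnion G.nbr) (fun u v => v ∈ G.nbr u)
    simp only [bipartiteAbove, bipartiteBelow] at h
    rw [← h, mul_comm, ← smul_eq_mul]
    refine sum_eq_card_nsmul fun u hu => ?_
    rw [← hG u]
    congr 1
    ext v
    simp only [mem_filter, mem_biUnion, and_iff_right_iff_imp]
    exact fun hv => ⟨u, hu, hv⟩
  have h2 : (G.uniqueNbrs S).card =
      ∑ v ∈ S.biUnion G.nbr, if ∃! u, u ∈ S ∧ v ∈ G.nbr u then 1 else 0 := by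
    rw [← card_filter]
    congr 1
    ext v
    simp only [uniqueNbrs, mem_filter, mem_univ, true_and, mem_biUnion]
    constructor
    · intro h
      exact ⟨h.exists, h⟩
    · exact fun h => h.2
  rw [h2, ← h1, ← sum_add_distrib, mul_comm, ← smul_eq_mul]
  refine card_nsmul_le_sum _ _ _ fun v hv => ?_
  obtain ⟨u, hu, huv⟩ := mem_biUnion.1 hv
  split_ifs with hun
  · have : 0 < (S.filter fun u => v ∈ G.nbr u).card :=
      card_pos.2 ⟨u, mem_filter.2 ⟨hu, huv⟩⟩
    omega
  · have : 1 < (S.filter fun u => v ∈ G.nbr u).card := by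
      by_contra! hle
      refine hun ⟨u, ⟨hu, huv⟩, fun w hw => ?_⟩
      exact card_le_one.1 hle w (mem_filter.2 hw) u (mem_filter.2 ⟨hu, huv⟩)
    omega

end BipartiteGraph

namespace RandomGraph

open Finset

/-- The ratio of the two binomials is a product of factors (a - i)/(r - i), each at most a/r. -/
theorem choose_mul_pow_le {a r : ℕ} (h : a ≤ r) (c : ℕ) :
    a.choose c * r ^ c ≤ r.choose c * a ^ c := by
  have key : a.descFactorial c * r ^ c ≤ r.descFactorial c * a ^ c := by
    induction c with
    | zero => simp
    | succ c ih =>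
      have h2 : (a - c) * r ≤ (r - c) * a := by
        rw [Nat.sub_mul, Nat.sub_mul, mul_comm r a]
        exact Nat.sub_le_sub_left (Nat.mul_le_mul_left c h) _
      calc a.descFactorial (c + 1) * r ^ (c + 1)
          = ((a - c) * r) * (a.descFactorial c * r ^ c) := by
            rw [Nat.descFactorial_succ]; ring
        _ ≤ ((r - c) * a) * (r.descFactorial c * a ^ c) := Nat.mul_le_mul h2 ih
        _ = r.descFactorial (c + 1) * a ^ (c + 1) := by
            rw [Nat.descFactorial_succ]; ring
  rw [Nat.descFactorial_eq_factorial_mul_choose, Nat.descFactorial_eq_factorial_mul_choose,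
    mul_assoc, mul_assoc] at key
  exact Nat.le_of_mul_le_mul_left key (Nat.factorial_pos c)

theorem choose_le_three_mul_div_pow (n : ℕ) {s : ℕ} (hs : 0 < s) :
    (n.choose s : ℝ) ≤ (3 * n / s) ^ s := by
  have hs' : (0 : ℝ) < s := by exact_mod_cast hs
  have hf : (0 : ℝ) < s.factorial := by exact_mod_cast Nat.factorial_pos s
  have h1 : (n.choose s : ℝ) ≤ n ^ s / s.factorial := Nat.choose_le_pow_div s n
  have h2 : (s : ℝ) ^ s / s.factorial ≤ 3 ^ s := by
    refine (Real.pow_div_factorial_le_exp _ hs'.le s).trans ?_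
    rw [← Real.exp_one_pow]
    exact pow_le_pow_left₀ (Real.exp_pos 1).le (by linarith [Real.exp_one_lt_d9]) s
  calc (n.choose s : ℝ) ≤ n ^ s / s.factorial := h1
    _ = (n / s) ^ s * (s ^ s / s.factorial) := by
        rw [div_pow]; field_simp
    _ ≤ (n / s) ^ s * 3 ^ s := by gcongr
    _ = (3 * n / s) ^ s := by rw [← mul_pow]; congr 1; ring

/-- The number of choices of `8`-element neighborhoods for which the neighborhoods of the vertices
in `S` lie in `T`. -/
theorem card_piFinset_confined {d r : ℕ} (S : Finset (Fin d)) (T : Finset (Fin r)) :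
    (Fintype.piFinset fun u => if u ∈ S then powersetCard 8 T else powersetCard 8 univ).card =
      (T.card.choose 8) ^ S.card * (r.choose 8) ^ (d - S.card) := by
  rw [Fintype.card_piFinset]
  have : ∀ u, (if u ∈ S then powersetCard 8 T else powersetCard 8 univ).card =
      if u ∈ S then T.card.choose 8 else r.choose 8 := by
    intro u
    split_ifs <;> simp
  simp only [this]
  rw [prod_ite, prod_const, prod_const]
  congr 2
  · congr 1
    ext; simp
  · rw [filter_not, card_sdiff_of_subset (filter_subset _ _)]
    simp

/-- Union bound by counting: if every choice of neighborhoods failed, each would confine some S of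
size s ≤ K to a set T of size exactly 6s (there is room for T since 6K ≤ r). The pairs (S, T)
account for less than all choices. -/
theorem exists_expanding_neighborhoods {d r K : ℕ} (hr : 8 ≤ r) (hK : 6 * K ≤ r)
    (hdr : 3 ^ 8 * 36 * d * K ≤ r ^ 2) :
    ∃ nbr : Fin d → Finset (Fin r), (∀ u, (nbr u).card = 8) ∧
      ∀ S : Finset (Fin d), S.card ≤ K → 6 * S.card ≤ (S.biUnion nbr).card := by
  by_contra! hcon
  have hsub : (Fintype.piFinset fun _ : Fin d => powersetCard 8 (univ : Finset (Fin r))) ⊆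
      (Icc 1 K).biUnion fun s => (powersetCard s univ).biUnion fun S : Finset (Fin d) =>
        (powersetCard (6 * s) univ).biUnion fun T : Finset (Fin r) =>
          Fintype.piFinset fun u => if u ∈ S then powersetCard 8 T else powersetCard 8 univ := by
    intro nbr hnbr
    simp only [Fintype.mem_piFinset, mem_powersetCard, subset_univ, true_and] at hnbr
    obtain ⟨S, hSK, hS⟩ := hcon nbr hnbr
    have hpos : 1 ≤ S.card := by
      by_contra! h0
      have : S.card = 0 := by omega
      simp [this] at hS
    obtain ⟨T, hT, hTc⟩ := exists_superset_card_eq (s := S.biUnion nbr) (n := 6 * S.card) hS.le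
      (by rw [Fintype.card_fin]; omega)
    simp only [mem_biUnion, mem_Icc, mem_powersetCard, subset_univ, true_and,
      Fintype.mem_piFinset]
    refine ⟨S.card, ⟨hpos, hSK⟩, S, rfl, T, hTc, fun u => ?_⟩
    split_ifs with hu
    · exact mem_powersetCard.2 ⟨(subset_biUnion_of_mem nbr hu).trans hT, hnbr u⟩
    · exact mem_powersetCard.2 ⟨subset_univ _, hnbr u⟩
  have hcard : (r.choose 8) ^ d ≤ ∑ s ∈ Icc 1 K, d.choose s * (r.choose (6 * s) *
      (((6 * s).choose 8) ^ s * (r.choose 8) ^ (d - s))) := by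
    have h := card_le_card hsub
    rw [Fintype.card_piFinset] at h
    simp only [card_powersetCard, card_univ, Fintype.card_fin, prod_const] at h
    refine h.trans (card_biUnion_le.trans (sum_le_sum fun s _ => ?_))
    refine (card_biUnion_le_card_mul _ _ (r.choose (6 * s) * _) fun S hS => ?_).trans_eq
      (by rw [card_powersetCard, card_univ, Fintype.card_fin])
    refine (card_biUnion_le_card_mul _ _ _ fun T hT => ?_).trans_eq
      (by rw [card_powersetCard, card_univ, Fintype.card_fin])
    rw [card_piFinset_confined, (mem_powersetCard.1 hS).2, (mem_powersetCard.1 hT).2]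
  have hrpos : (0 : ℝ) < r := by exact_mod_cast (by omega : 0 < r)
  have hC : (0 : ℝ) < r.choose 8 := by exact_mod_cast Nat.choose_pos hr
  have hterm : ∀ s ∈ Icc 1 K, ((d.choose s * (r.choose (6 * s) *
      (((6 * s).choose 8) ^ s * (r.choose 8) ^ (d - s))) : ℕ) : ℝ) ≤
        (1 / 3) ^ s * (r.choose 8 : ℝ) ^ d := by
    intro s hs
    rw [mem_Icc] at hs
    have hs0 : (0 : ℝ) < s := by exact_mod_cast hs.1
    rcases lt_or_ge d s with hlt | hle
    · rw [Nat.choose_eq_zero_of_lt hlt, zero_mul, Nat.cast_zero]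
      positivity
    have h1 : ((6 * s).choose 8 : ℝ) ≤ r.choose 8 * (6 * s / r) ^ 8 := by
      have := choose_mul_pow_le (show 6 * s ≤ r by omega) 8
      rw [div_pow, ← mul_div_assoc, le_div_iff₀ (by positivity)]
      exact_mod_cast this
    have h2 := choose_le_three_mul_div_pow d hs.1
    have h3 := choose_le_three_mul_div_pow r (show 0 < 6 * s by omega)
    -- This is the base of the s-th power left after estimating all binomials. The assumption on d,
    -- K and r is made so that it is at most 1/3, and the geometric series then stays below 1.
    have h4 : (3 ^ 7 * 36 * d * s / r ^ 2 : ℝ) ≤ 1 / 3 := by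
      rw [div_le_iff₀ (by positivity)]
      have : (3 ^ 8 * 36 * d * K : ℝ) ≤ r ^ 2 := by exact_mod_cast hdr
      have hsK : (s : ℝ) ≤ K := by exact_mod_cast hs.2
      have : (d : ℝ) * s ≤ d * K := by gcongr
      linarith
    push_cast at h3 ⊢
    calc (d.choose s : ℝ) * (r.choose (6 * s) * (((6 * s).choose 8 : ℝ) ^ s *
          (r.choose 8 : ℝ) ^ (d - s)))
        ≤ (3 * d / s) ^ s * ((3 * r / (6 * s)) ^ (6 * s) *
          ((r.choose 8 * (6 * s / r) ^ 8) ^ s * (r.choose 8 : ℝ) ^ (d - s))) := by gcongr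
      _ = (3 ^ 7 * 36 * d * s / r ^ 2) ^ s *
          ((r.choose 8 : ℝ) ^ s * (r.choose 8 : ℝ) ^ (d - s)) := by
          have e : (3 ^ 7 * 36 * d * s / r ^ 2 : ℝ) =
              3 * d / s * (3 * r / (6 * s)) ^ 6 * (6 * s / r) ^ 8 := by
            field_simp
            ring
          rw [e, pow_mul, mul_pow, mul_pow, mul_pow]
          ring
      _ ≤ (1 / 3) ^ s * ((r.choose 8 : ℝ) ^ s * (r.choose 8 : ℝ) ^ (d - s)) := by gcongr
      _ = (1 / 3) ^ s * (r.choose 8 : ℝ) ^ d := by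
          rw [← pow_add, Nat.add_sub_cancel' hle]
  have hle : (r.choose 8 : ℝ) ^ d ≤ (∑ s ∈ Icc 1 K, (1 / 3 : ℝ) ^ s) * (r.choose 8 : ℝ) ^ d := by
    rw [sum_mul]
    refine le_trans ?_ (sum_le_sum hterm)
    exact_mod_cast hcard
  have hgeom : ∑ s ∈ Icc 1 K, (1 / 3 : ℝ) ^ s < 1 := by
    have : ∀ K : ℕ, ∑ s ∈ Icc 1 K, (1 / 3 : ℝ) ^ s = (1 - (1 / 3) ^ K) / 2 := by
      intro K
      induction K with
      | zero => simp
      | succ K ih => rw [sum_Icc_succ_top (by omega), ih, pow_succ]; ring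
    rw [this]
    have : (0 : ℝ) < (1 / 3) ^ K := by positivity
    linarith
  have := mul_lt_mul_of_pos_right hgeom (pow_pos hC d)
  linarith

/-- Unbalanced unique-neighbor expanders of every large enough size. -/
theorem exists_isUNExpander {β : ℝ} (hβ : 0 < β) (hβ₁ : β ≤ 1) :
    ∃ δ : ℝ, 0 < δ ∧ δ ≤ 1 ∧ ∃ D : ℕ, ∀ d ≥ D, ∃ r : ℕ, 8 * (r : ℝ) ≤ β * d ∧
      ∃ G : BipartiteGraph (Fin d) (Fin r), G.IsUNExpander 8 δ (1 / 2) := by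
  -- The denominator is 3^8 · 36 · 16², matching r ≥ βd/16 in the counting condition. The bound d ≥
  -- 128/β gives r ≥ 8 and ensures that rounding βd/8 down loses at most half.
  refine ⟨β ^ 2 / 60466176, by positivity, ?_, ⌈128 / β⌉₊, fun d hd => ?_⟩
  · rw [div_le_one (by norm_num)]
    nlinarith
  have hd' : 128 ≤ β * d := by
    have := (Nat.le_ceil (128 / β)).trans (Nat.cast_le.2 hd)
    rwa [div_le_iff₀ hβ, mul_comm] at this
  have hfl := Nat.floor_le (show 0 ≤ β * d / 8 by positivity)
  have hfl' := Nat.lt_floor_add_one (β * d / 8)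
  set r := ⌊β * d / 8⌋₊ with hr
  set K := ⌊β ^ 2 / 60466176 * d⌋₊ with hK
  have hKle := Nat.floor_le (show 0 ≤ β ^ 2 / 60466176 * d by positivity)
  rw [← hK] at hKle
  have hr16 : β * d / 16 ≤ r := by linarith
  have hKβ : (K : ℝ) * 60466176 ≤ β * (β * d) := by linarith
  obtain ⟨nbr, hc, hnbr⟩ := exists_expanding_neighborhoods (d := d) (r := r) (K := K)
    (by
      have : (8 : ℝ) ≤ r := by linarith
      exact_mod_cast this)
    (by
      have : 6 * (K : ℝ) ≤ r := by nlinarith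
      exact_mod_cast this)
    (by
      have : 3 ^ 8 * 36 * d * (K : ℝ) ≤ r ^ 2 := by
        have h1 : (β * d / 16) ^ 2 ≤ (r : ℝ) ^ 2 := by gcongr
        have h2 : d * ((K : ℝ) * 60466176) ≤ d * (β * (β * d)) := by gcongr
        linarith
      exact_mod_cast this)
  refine ⟨r, by linarith, ⟨nbr⟩, hc, fun S _ hS => ?_⟩
  rw [Fintype.card_fin] at hS
  have h1 := hnbr S (Nat.le_floor hS.le)
  have h2 := BipartiteGraph.two_mul_card_biUnion_le ⟨nbr⟩ hc S
  have h3 : 4 * S.card ≤ (BipartiteGraph.uniqueNbrs ⟨nbr⟩ S).card := by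
    simp only at h2
    omega
  have h4 : 4 * (S.card : ℝ) ≤ (BipartiteGraph.uniqueNbrs ⟨nbr⟩ S).card := by exact_mod_cast h3
  push_cast
  linarith

end RandomGraph

/-! ### Unique-neighbor expansion of routed products -/

namespace BipartiteGraph

open Finset

variable {L R R' : Type}

/-- The bipartite graph obtained by renaming the right vertices. -/
def mapRight (G : BipartiteGraph L R) (f : R ≃ R') : BipartiteGraph L R' where
  nbr u := (G.nbr u).map f.toEmbedding

theorem mem_uniqueNbrs [Fintype R] (G : BipartiteGraph L R) (S : Finset L) (v : R) :
    v ∈ G.uniqueNbrs S ↔ ∃! u, u ∈ S ∧ v ∈ G.nbr u := by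
  simp [uniqueNbrs]

theorem card_uniqueNbrs_mapRight [Fintype R] [Fintype R'] (G : BipartiteGraph L R) (f : R ≃ R')
    (S : Finset L) : ((G.mapRight f).uniqueNbrs S).card = (G.uniqueNbrs S).card := by
  have : (G.mapRight f).uniqueNbrs S = (G.uniqueNbrs S).map f.toEmbedding := by
    ext v
    obtain ⟨w, rfl⟩ := f.surjective v
    change _ ↔ f.toEmbedding w ∈ _
    rw [mem_map', mem_uniqueNbrs, mem_uniqueNbrs]
    simp only [mapRight, mem_map_equiv, Equiv.symm_apply_apply]
  rw [this, card_map]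

theorem card_nbr_mapRight (G : BipartiteGraph L R) (f : R ≃ R') (u : L) :
    ((G.mapRight f).nbr u).card = (G.nbr u).card :=
  card_map _

theorem isUNExpander_mapRight [Fintype L] [Fintype R] [Fintype R'] {G : BipartiteGraph L R}
    {c : ℕ} {δ α : ℝ} (hG : G.IsUNExpander c δ α) (f : R ≃ R') :
    (G.mapRight f).IsUNExpander c δ α := by
  refine ⟨fun u => (card_nbr_mapRight G f u).trans (hG.1 u), fun S hS hSδ => ?_⟩
  rw [card_uniqueNbrs_mapRight]
  exact hG.2 S hS hSδ

-- Above a fixed outer vertex v the product is a copy of the inner graph, with the edges at v in the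
-- role of its left vertices; hence uniqueness can be tested one v at a time.
open scoped Classical in
theorem card_uniqueNbrs_routedProduct {d : ℕ} [Fintype R] [Fintype R']
    (G : BipartiteGraph L R) (ord : ∀ v : R, Fin d ≃ {u : L // v ∈ G.nbr u})
    (G' : BipartiteGraph (Fin d) R') (S : Finset L) :
    ((G.routedProduct ord G').uniqueNbrs S).card =
      ∑ v, (G'.uniqueNbrs (univ.filter fun i => (ord v i : L) ∈ S)).card := by
  simp only [uniqueNbrs, card_filter, Fintype.sum_prod_type]
  refine sum_congr rfl fun v _ => sum_congr rfl fun v' _ => ?_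
  congr 1
  simp only [routedProduct, mem_filter, mem_univ, true_and, eq_iff_iff]
  constructor
  · rintro ⟨u, ⟨hu, i, rfl, hi⟩, huniq⟩
    refine ⟨i, ⟨hu, hi⟩, fun j hj => ?_⟩
    exact (ord v).injective (Subtype.ext (huniq _ ⟨hj.1, j, rfl, hj.2⟩))
  · rintro ⟨i, ⟨hu, hi⟩, huniq⟩
    refine ⟨ord v i, ⟨hu, i, rfl, hi⟩, ?_⟩
    rintro w ⟨hw, j, rfl, hj⟩
    rw [huniq j ⟨hw, hj⟩]

end BipartiteGraph

namespace PermGraph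

open Finset

variable {N d r : ℕ} (π : Fin d → Equiv.Perm (Fin N))

/-- The left endpoint of an edge. -/
def lft (e : Fin (N * d)) : Fin (N + N) := Fin.castAdd N e.divNat

/-- The right endpoint of an edge. -/
def rgt (e : Fin (N * d)) : Fin (N + N) := Fin.natAdd N (π e.modNat e.divNat)

theorem mem_ends_iff_eq (p : Fin (N + N)) (e : Fin (N * d)) :
    p ∈ (graph π).ends e ↔ p = lft e ∨ p = rgt π e := by
  simp [graph, lft, rgt]

theorem lft_ne_rgt (e : Fin (N * d)) : lft e ≠ rgt π e := castAdd_ne_natAdd _ _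

/-- The routed product of the incidence graph with an inner graph. -/
noncomputable def product (G' : BipartiteGraph (Fin d) (Fin r)) :
    BipartiteGraph (Fin (N * d)) (Fin (N + N) × Fin r) :=
  (graph π).incidenceGraph.routedProduct (ord π) G'

theorem mem_product_nbr (G' : BipartiteGraph (Fin d) (Fin r)) (e : Fin (N * d))
    (q : Fin (N + N) × Fin r) :
    q ∈ (product π G').nbr e ↔ (q.1 = lft e ∨ q.1 = rgt π e) ∧ q.2 ∈ G'.nbr e.modNat := by
  simp only [product, BipartiteGraph.routedProduct, mem_filter, mem_univ, true_and, ord_eq_iff,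
    mem_ends_iff_eq]
  constructor
  · rintro ⟨i, ⟨h, rfl⟩, h'⟩
    exact ⟨h, h'⟩
  · rintro ⟨h, h'⟩
    exact ⟨_, ⟨h, rfl⟩, h'⟩

theorem product_isLeftRegular {G' : BipartiteGraph (Fin d) (Fin r)} {c : ℕ}
    (hG' : G'.IsLeftRegular c) : (product π G').IsLeftRegular (2 * c) := by
  intro e
  have : (product π G').nbr e = ({lft e, rgt π e} : Finset _) ×ˢ G'.nbr e.modNat := by
    ext q
    rw [mem_product_nbr, mem_product, mem_insert, mem_singleton]
  rw [this, card_product, hG', card_pair (lft_ne_rgt π e)]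

/-- The edges of `S` at the vertex `p`, given by their positions. -/
noncomputable def view (S : Finset (Fin (N * d))) (p : Fin (N + N)) : Finset (Fin d) :=
  univ.filter fun i => (ord π p i : Fin (N * d)) ∈ S

theorem card_view (S : Finset (Fin (N * d))) (p : Fin (N + N)) :
    (view π S p).card = ∑ e ∈ S, ((if p = lft e then 1 else 0) + if p = rgt π e then 1 else 0) := by
  have h : (view π S p).card = (S.filter fun e => p ∈ (graph π).ends e).card := by
    refine card_bij' (fun i _ => (ord π p i : Fin (N * d))) (fun e _ => e.modNat) ?_ ?_ ?_ ?_
    · intro i hi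
      exact mem_filter.2 ⟨(mem_filter.1 hi).2, ((ord_eq_iff π p i _).1 rfl).1⟩
    · intro e he
      rw [mem_filter] at he
      rw [view, mem_filter, (ord_eq_iff π p e.modNat e).2 ⟨he.2, rfl⟩]
      exact ⟨mem_univ _, he.1⟩
    · intro i _
      exact ((ord_eq_iff π p i _).1 rfl).2
    · intro e he
      exact (ord_eq_iff π p e.modNat e).2 ⟨(mem_filter.1 he).2, rfl⟩
  rw [h, card_filter]
  refine sum_congr rfl fun e _ => ?_
  have := lft_ne_rgt π e
  simp only [mem_ends_iff_eq]
  split_ifs <;> simp_all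

theorem sum_card_view (S : Finset (Fin (N * d))) (T : Finset (Fin (N + N))) :
    ∑ p ∈ T, (view π S p).card =
      ∑ e ∈ S, ((if lft e ∈ T then 1 else 0) + if rgt π e ∈ T then 1 else 0) := by
  simp only [card_view]
  rw [sum_comm]
  refine sum_congr rfl fun e _ => ?_
  rw [sum_add_distrib, sum_ite_eq', sum_ite_eq']

/-- An edge of S is seen from T at most once, except for a second time when both its ends lie in T.
-/
theorem sum_card_view_le (S : Finset (Fin (N * d))) (T : Finset (Fin (N + N))) :
    ∑ p ∈ T, (view π S p).card ≤
      S.card + (univ.filter fun e : Fin (N * d) => lft e ∈ T ∧ rgt π e ∈ T).card := by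
  have h3 : ∑ e ∈ S, (if lft e ∈ T ∧ rgt π e ∈ T then 1 else 0) ≤
      (univ.filter fun e : Fin (N * d) => lft e ∈ T ∧ rgt π e ∈ T).card := by
    rw [card_filter]
    exact sum_le_sum_of_subset_of_nonneg (subset_univ S) fun _ _ _ => by positivity
  refine le_trans ?_ (Nat.add_le_add_left h3 _)
  rw [sum_card_view, card_eq_sum_ones, ← sum_add_distrib]
  exact sum_le_sum fun e _ => by split_ifs <;> simp_all

/-- If the outer edges are seen at most `D` at a time outside `T`, the inner expander gives them
many unique neighbors. -/
theorem sum_card_view_le_card_uniqueNbrs {G' : BipartiteGraph (Fin d) (Fin r)} {c : ℕ} {δ : ℝ}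
    (hG' : G'.IsUNExpander c δ (1 / 2)) (S : Finset (Fin (N * d))) (T : Finset (Fin (N + N)))
    (hT : ∀ p ∈ T, ((view π S p).card : ℝ) < δ * d) :
    1 / 2 * c * ∑ p ∈ T, ((view π S p).card : ℝ) ≤ ((product π G').uniqueNbrs S).card := by
  rw [product, BipartiteGraph.card_uniqueNbrs_routedProduct, Nat.cast_sum, mul_sum]
  refine (sum_le_sum fun p hp => ?_).trans
    (sum_le_sum_of_subset_of_nonneg (subset_univ T) fun _ _ _ => by positivity)
  rcases (view π S p).eq_empty_or_nonempty with h | h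
  · rw [h, card_empty, Nat.cast_zero, mul_zero]
    exact Nat.cast_nonneg _
  · have h' := hG'.2 _ h (by rw [Fintype.card_fin]; exact hT p hp)
    refine h'.trans_eq ?_
    congr 3
    ext i
    simp only [view, mem_filter]

variable {π}

/-- Expander mixing: a set of vertices spans few edges. -/
theorem card_inner_edges_le [NeZero N] {lam : ℝ} (hlam : 0 < lam)
    (hπ : IsContracting π (lam ^ 2)) (T : Finset (Fin (N + N))) :
    ((univ.filter fun e : Fin (N * d) => lft e ∈ T ∧ rgt π e ∈ T).card : ℝ) ≤
      d * T.card ^ 2 / (4 * N) + lam * T.card / 2 := by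
  have hN : (0 : ℝ) < N := by exact_mod_cast Nat.pos_of_ne_zero (NeZero.ne N)
  let x : Fin N → ℝ := fun v => if Fin.castAdd N v ∈ T then 1 else 0
  let y : Fin N → ℝ := fun w => if Fin.natAdd N w ∈ T then 1 else 0
  have hT : (T.card : ℝ) = ∑ v, x v + ∑ w, y w := by
    simp only [x, y, ← Fin.sum_univ_add fun p => if p ∈ T then (1 : ℝ) else 0]
    simp
  have hx2 : ∑ v, x v ^ 2 = ∑ v, x v := sum_congr rfl fun v _ => by simp [x]
  have hy2 : ∑ v, y v ^ 2 = ∑ v, y v := sum_congr rfl fun v _ => by simp [y]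
  have he : ((univ.filter fun e : Fin (N * d) => lft e ∈ T ∧ rgt π e ∈ T).card : ℝ) =
      ∑ v, x v * ∑ i, y (π i v) := by
    rw [card_filter, Nat.cast_sum, ← Equiv.sum_comp finProdFinEquiv, Fintype.sum_prod_type]
    refine sum_congr rfl fun v _ => ?_
    rw [mul_sum]
    refine sum_congr rfl fun i _ => ?_
    have h := finProdFinEquiv.symm_apply_apply (v, i)
    rw [finProdFinEquiv_symm_apply, Prod.mk.injEq] at h
    simp only [lft, rgt, h.1, h.2, x, y]
    split_ifs <;> simp_all
  set X := ∑ v, x v with hX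
  set Y := ∑ w, y w with hY
  set g : Fin N → ℝ := fun w => y w - Y / N with hg
  have hg0 : ∑ w, g w = 0 := by
    simp only [hg, sum_sub_distrib, ← hY, sum_const, card_univ, Fintype.card_fin, nsmul_eq_mul]
    rw [mul_div_cancel₀ _ hN.ne', sub_self]
  have hg2 : ∑ w, g w ^ 2 ≤ Y := by
    have e1 : ∀ w, g w ^ 2 = y w ^ 2 - 2 * (Y / N) * y w + (Y / N) ^ 2 := fun w => by
      simp only [hg]; ring
    simp only [e1, sum_add_distrib, sum_sub_distrib, ← mul_sum, hy2, ← hY, sum_const, card_univ,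
      Fintype.card_fin, nsmul_eq_mul]
    have e2 : (N : ℝ) * (Y / N) ^ 2 = Y / N * Y := by field_simp
    have e3 : 0 ≤ Y / N * Y := by
      rw [← e2]; positivity
    linarith
  -- Split y into its mean and a part g of mean zero. The mean gives the main term; AM-GM with
  -- weight `lam` prepares the g-part for the contraction bound.
  have h1 : ∀ v, x v * ∑ i, y (π i v) ≤
      d * (Y / N) * x v + (lam / 2 * x v ^ 2 + 1 / (2 * lam) * (∑ i, g (π i v)) ^ 2) := by
    intro v
    have e1 : ∑ i, y (π i v) = d * (Y / N) + ∑ i, g (π i v) := by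
      simp [hg, sum_sub_distrib]
    rw [e1]
    set u := ∑ i, g (π i v)
    have e2 : lam / 2 * x v ^ 2 + 1 / (2 * lam) * u ^ 2 - x v * u =
        (lam * x v - u) ^ 2 / (2 * lam) := by field_simp; ring
    have e3 : 0 ≤ (lam * x v - u) ^ 2 / (2 * lam) := by positivity
    linarith
  have h2 := sum_le_sum fun v (_ : v ∈ univ) => h1 v
  rw [sum_add_distrib, sum_add_distrib, ← mul_sum, ← mul_sum, ← mul_sum, hx2, ← hX] at h2
  have h3 : 1 / (2 * lam) * ∑ v, (∑ i, g (π i v)) ^ 2 ≤ lam / 2 * Y := by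
    calc 1 / (2 * lam) * ∑ v, (∑ i, g (π i v)) ^ 2 ≤ 1 / (2 * lam) * (lam ^ 2 * Y) := by
          have := (hπ g hg0).trans (mul_le_mul_of_nonneg_left hg2 (sq_nonneg lam))
          gcongr
      _ = lam / 2 * Y := by field_simp
  have h4 : d * (Y / N) * X ≤ d * T.card ^ 2 / (4 * N) := by
    rw [hT, show d * (Y / N) * X = d * (4 * (X * Y)) / (4 * N) by field_simp]
    have : 4 * (X * Y) ≤ (X + Y) ^ 2 := by nlinarith [sq_nonneg (X - Y)]
    gcongr
  rw [he]
  rw [hT] at h4 ⊢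
  linarith

/-- Let T be the heavy vertices and A the number of edge ends at T. Mixing bounds the edges inside T
by A/4, so A ≤ |S| + A/4 and at least (2/3)|S| ends are at light vertices. The inner factor c/2
turns this into (c/3)|S|, which is 1/6 of 2c|S|. -/
theorem product_isUNExpander [NeZero N] [NeZero d] {G' : BipartiteGraph (Fin d) (Fin r)} {c : ℕ}
    {δ : ℝ} (hδ : 0 < δ) (hG' : G'.IsUNExpander c δ (1 / 2))
    (hπ : IsContracting π ((δ / 4 * d) ^ 2)) :
    (product π G').IsUNExpander (2 * c) (δ ^ 2 / 4) (1 / 6) := by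
  classical
  have hd : (0 : ℝ) < d := by exact_mod_cast Nat.pos_of_ne_zero (NeZero.ne d)
  have hN : (0 : ℝ) < N := by exact_mod_cast Nat.pos_of_ne_zero (NeZero.ne N)
  refine ⟨product_isLeftRegular π hG'.1, fun S _ hS => ?_⟩
  rw [Fintype.card_fin] at hS
  push_cast at hS
  set T : Finset (Fin (N + N)) := univ.filter fun p => δ * d ≤ (view π S p).card with hTdef
  have htot : ∑ p, ((view π S p).card : ℝ) = 2 * S.card := by
    have := sum_card_view π S univ
    simp only [mem_univ, if_true, sum_const, smul_eq_mul] at this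
    rw [← Nat.cast_sum, this]
    push_cast
    ring
  have hsplit : ∑ p ∈ T, ((view π S p).card : ℝ) + ∑ p ∈ Tᶜ, ((view π S p).card : ℝ) =
      2 * S.card := by rw [sum_add_sum_compl, htot]
  set A := ∑ p ∈ T, ((view π S p).card : ℝ) with hA
  have hAT : δ * d * T.card ≤ A := by
    rw [mul_comm, ← nsmul_eq_mul]
    exact card_nsmul_le_sum _ _ _ fun p hp => (mem_filter.1 hp).2
  have hin := card_inner_edges_le (d := d) (by positivity) hπ T
  set a := ((univ.filter fun e : Fin (N * d) => lft e ∈ T ∧ rgt π e ∈ T).card : ℝ) with ha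
  have hAa : A ≤ S.card + a := by
    rw [hA, ha]
    exact_mod_cast sum_card_view_le π S T
  -- Each heavy vertex takes δd of the 2|S| < δ²Nd/2 edge ends. With this size both terms of the
  -- mixing bound are at most δd|T|/8.
  have hTsmall : (T.card : ℝ) ≤ δ * N / 2 := by
    have hnn : 0 ≤ ∑ p ∈ Tᶜ, ((view π S p).card : ℝ) := sum_nonneg fun _ _ => by positivity
    have : (T.card : ℝ) * (δ * d) ≤ (δ * N / 2) * (δ * d) := by nlinarith
    exact le_of_mul_le_mul_right this (by positivity)
  have ha4 : a ≤ δ * d * T.card / 4 := by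
    have : (d : ℝ) * T.card ^ 2 / (4 * N) ≤ δ * d * T.card / 8 := by
      rw [div_le_iff₀ (by positivity)]
      have := mul_le_mul_of_nonneg_left hTsmall (show (0 : ℝ) ≤ d * T.card by positivity)
      linarith
    linarith
  have hlow : 2 / 3 * (S.card : ℝ) ≤ ∑ p ∈ Tᶜ, ((view π S p).card : ℝ) := by linarith
  have huniq : 1 / 2 * c * ∑ p ∈ Tᶜ, ((view π S p).card : ℝ) ≤
      ((product π G').uniqueNbrs S).card := by
    refine sum_card_view_le_card_uniqueNbrs π hG' S Tᶜ fun p hp => ?_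
    rw [hTdef, mem_compl, mem_filter, not_and, not_le] at hp
    exact hp (mem_univ p)
  refine le_trans ?_ huniq
  push_cast
  have hc : (0 : ℝ) ≤ c := Nat.cast_nonneg c
  nlinarith [mul_le_mul_of_nonneg_left hlow hc]

end PermGraph

/-! ### Random access machine programs -/

namespace RamProgram

/-- The program consists of assignments, prints and case distinctions only. -/
def LoopFree : RamProgram → Prop
  | seq p q => p.LoopFree ∧ q.LoopFree
  | ite _ p q => p.LoopFree ∧ q.LoopFree
  | loop _ _ => False
  | _ => True

/-- A bound for the number of steps of a loop-free program. -/
def cost : RamProgram → ℕ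
  | seq p q => p.cost + q.cost
  | ite _ p q => max p.cost q.cost + 1
  | _ => 1

/-- The effect of a loop-free program. -/
def exec : RamProgram → RamState → RamState
  | const i k, s => s.write i k
  | copy i j, s => s.write i (s.reg j)
  | add i j k, s => s.write i (s.reg j + s.reg k)
  | sub i j k, s => s.write i (s.reg j - s.reg k)
  | load i j, s => s.write i (s.reg (s.reg j))
  | store i j, s => s.write (s.reg i) (s.reg j)
  | print i, s => ⟨s.reg, s.out ++ [s.reg i]⟩
  | seq p q, s => q.exec (p.exec s)
  | ite i p q, s => if s.reg i = 0 then q.exec s else p.exec s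
  | loop _ _, s => s

theorem LoopFree.exists_run {p : RamProgram} (hp : p.LoopFree) (s : RamState) :
    ∃ t ≤ p.cost, RamRun p s t (p.exec s) := by
  induction p generalizing s with
  | const i k => exact ⟨1, le_rfl, .const i k s⟩
  | copy i j => exact ⟨1, le_rfl, .copy i j s⟩
  | add i j k => exact ⟨1, le_rfl, .add i j k s⟩
  | sub i j k => exact ⟨1, le_rfl, .sub i j k s⟩
  | load i j => exact ⟨1, le_rfl, .load i j s⟩
  | store i j => exact ⟨1, le_rfl, .store i j s⟩
  | print i => exact ⟨1, le_rfl, .print i s⟩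
  | seq p q ihp ihq =>
    obtain ⟨t₁, ht₁, h₁⟩ := ihp hp.1 s
    obtain ⟨t₂, ht₂, h₂⟩ := ihq hp.2 (p.exec s)
    exact ⟨t₁ + t₂, Nat.add_le_add ht₁ ht₂, .seq h₁ h₂⟩
  | ite i p q ihp ihq =>
    by_cases hi : s.reg i = 0
    · obtain ⟨t, ht, h⟩ := ihq hp.2 s
      refine ⟨t + 1, Nat.succ_le_succ (ht.trans (le_max_right _ _)), ?_⟩
      rw [exec, if_pos hi]
      exact .ite_false hi h
    · obtain ⟨t, ht, h⟩ := ihp hp.1 s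
      refine ⟨t + 1, Nat.succ_le_succ (ht.trans (le_max_left _ _)), ?_⟩
      rw [exec, if_neg hi]
      exact .ite_true hi h
  | loop i p => exact hp.elim

/-- The invariant is indexed by the number of remaining iterations, so it yields termination,
correctness and the time bound in one induction. -/
theorem LoopFree.exists_run_loop {p : RamProgram} (hp : p.LoopFree) {i : ℕ}
    {I : ℕ → RamState → Prop} (h0 : ∀ s, I 0 s → s.reg i = 0)
    (hstep : ∀ j s, I (j + 1) s → s.reg i ≠ 0 ∧ I j (p.exec s)) {j : ℕ} {s : RamState}
    (hs : I j s) :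
    ∃ t ≤ j * (p.cost + 1) + 1, ∃ s', RamRun (loop i p) s t s' ∧ I 0 s' := by
  induction j generalizing s with
  | zero => exact ⟨1, by omega, s, .loop_done (h0 s hs), hs⟩
  | succ j ih =>
    obtain ⟨hi, hj⟩ := hstep j s hs
    obtain ⟨t₁, ht₁, h₁⟩ := hp.exists_run s
    obtain ⟨t₂, ht₂, s', h₂, hs'⟩ := ih hj
    refine ⟨t₁ + t₂ + 1, ?_, s', .loop_step hi h₁ h₂, hs'⟩
    rw [Nat.succ_mul]
    omega

/-- Run programs one after the other. -/
def seqList : List RamProgram → RamProgram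
  | [] => copy 0 0
  | p :: ps => seq p (seqList ps)

theorem loopFree_seqList {ps : List RamProgram} (h : ∀ p ∈ ps, p.LoopFree) :
    (seqList ps).LoopFree := by
  induction ps with
  | nil => trivial
  | cons p ps ih =>
    exact ⟨h p (List.mem_cons_self), ih fun q hq => h q (List.mem_cons_of_mem _ hq)⟩

theorem exec_seqList_nil (s : RamState) : (seqList []).exec s = s := by
  simp [seqList, exec, RamState.write]

theorem exec_seqList {I : ℕ → RamState → Prop} {ps : List RamProgram}
    (hstep : ∀ j (hj : j < ps.length) s, I j s → I (j + 1) (ps[j].exec s)) {s : RamState}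
    (hs : I 0 s) : I ps.length ((seqList ps).exec s) := by
  induction ps generalizing I s with
  | nil => rwa [exec_seqList_nil]
  | cons p ps ih =>
    exact ih (I := fun j => I (j + 1))
      (fun j hj s h => hstep (j + 1) (Nat.succ_lt_succ hj) s h)
      (hstep 0 (Nat.succ_pos _) s hs)

/-- Multiply a register by a constant. -/
def mulConst (i j c : ℕ) : RamProgram :=
  seq (const i 0) (seqList (List.replicate c (add i i j)))

theorem loopFree_mulConst (i j c : ℕ) : (mulConst i j c).LoopFree :=
  ⟨trivial, loopFree_seqList fun p hp => by rw [List.eq_of_mem_replicate hp]; trivial⟩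

theorem exec_mulConst {i j : ℕ} (hij : i ≠ j) (c : ℕ) (s : RamState) :
    (mulConst i j c).exec s = s.write i (c * s.reg j) := by
  have := exec_seqList (I := fun k s' => s' = s.write i (k * s.reg j))
    (ps := List.replicate c (add i i j)) (s := s.write i 0) (by
      rintro k hk _ rfl
      simp [exec, RamState.write, hij.symm, Nat.succ_mul]) (by simp)
  rwa [List.length_replicate] at this

end RamProgram

/-! ### Machine programs for walks on the torus and the edges at a vertex. -/

namespace Torus

open RamProgram

/-- Coordinates of the vertices as natural numbers below the side length `m`. -/
def natGen (m : ℕ) (g : Fin 5) (z : ℕ × ℕ) : ℕ × ℕ :=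
  match g with
  | 0 => z
  | 1 => ((z.1 + z.2) % m, z.2)
  | 2 => (z.1, (z.1 + z.2) % m)
  | 3 => ((z.1 + 1) % m, z.2)
  | 4 => (z.1, (z.2 + 1) % m)

/-- Follow a word of generators. -/
def natWalk (m : ℕ) : List (Fin 5) → ℕ × ℕ → ℕ × ℕ
  | [], z => z
  | g :: w, z => natWalk m w (natGen m g z)

/-- The contents of the registers when the vertex `v = x * m + y` and the edge `e` are processed;
`a` vertices remain and `o` has been printed. -/
structure Regs (l m a x y v e : ℕ) (o : List ℕ) (s : RamState) : Prop where
  one : s.reg 1 = 1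
  side : s.reg 2 = m
  edges : s.reg 3 = l
  fst : s.reg 6 = x
  snd : s.reg 7 = y
  count : s.reg 8 = a
  edge : s.reg 12 = e
  vertex : s.reg 13 = v
  area : s.reg 14 = m * m
  snd_mul : s.reg 22 = y * m
  out : s.out = o

/-- The listed registers are scratch space: no field of `Regs` reads them. -/
theorem Regs.write {l m a x y v e : ℕ} {o : List ℕ} {s : RamState} (h : Regs l m a x y v e o s)
    {i : ℕ} (hi : i ∈ [5, 10, 11, 15, 18, 20, 21]) (k : ℕ) :
    Regs l m a x y v e o (s.write i k) := by
  simp only [List.mem_cons, List.not_mem_nil, or_false] at hi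
  obtain ⟨h1, h2, h3, h4, h5, h6, h7, h8, h9, h10, h11⟩ := h
  rcases hi with rfl | rfl | rfl | rfl | rfl | rfl | rfl <;>
    constructor <;> simpa [RamState.write]

/-- The registers hold a second vertex `z`. -/
structure Pos (m : ℕ) (z : ℕ × ℕ) (s : RamState) : Prop where
  fst : s.reg 10 = z.1
  snd : s.reg 11 = z.2
  fst_mul : s.reg 20 = z.1 * m
  snd_mul : s.reg 21 = z.2 * m

/-- Reduce a coordinate modulo the side length. -/
def reduceProg (i j : ℕ) : RamProgram :=
  seq (sub 5 2 i) (ite 5 (copy 0 0) (seq (sub i i 2) (sub j j 14)))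

/-- Apply a generator to the second vertex. -/
def genProg (g : Fin 5) : RamProgram :=
  match g with
  | 0 => copy 0 0
  | 1 => seq (add 10 10 11) (seq (add 20 20 21) (reduceProg 10 20))
  | 2 => seq (add 11 10 11) (seq (add 21 20 21) (reduceProg 11 21))
  | 3 => seq (add 10 10 1) (seq (add 20 20 2) (reduceProg 10 20))
  | 4 => seq (add 11 11 1) (seq (add 21 21 2) (reduceProg 11 21))

theorem loopFree_genProg (g : Fin 5) : (genProg g).LoopFree := by
  fin_cases g <;> simp [genProg, reduceProg, LoopFree]

theorem copy_self_exec (s : RamState) : (copy 0 0).exec s = s := by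
  simp [exec, RamState.write]

theorem natGen_lt {m : ℕ} {g : Fin 5} {z : ℕ × ℕ} (h1 : z.1 < m) (h2 : z.2 < m) :
    (natGen m g z).1 < m ∧ (natGen m g z).2 < m := by
  have hm : 0 < m := by omega
  fin_cases g <;> simp [natGen, h1, h2, Nat.mod_lt _ hm]

section Programs

variable {l m a x y v e : ℕ} {o : List ℕ} {s : RamState} {z : ℕ × ℕ}

/-- Below 2m a single conditional subtraction of m reduces modulo m. The stored multiple of the
coordinate drops by m², which is kept in register 14. -/
theorem exec_reduceProg_left {u : ℕ} (h : Regs l m a x y v e o s) (hu : u < 2 * m)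
    (h1 : s.reg 10 = u) (h2 : s.reg 11 = z.2) (h3 : s.reg 20 = u * m) (h4 : s.reg 21 = z.2 * m) :
    Regs l m a x y v e o ((reduceProg 10 20).exec s) ∧
      Pos m (u % m, z.2) ((reduceProg 10 20).exec s) := by
  by_cases hlt : u < m
  · have hne : m - u ≠ 0 := by omega
    have he : (reduceProg 10 20).exec s = s.write 5 (m - u) := by
      simp [reduceProg, exec, RamState.write, h.side, h1, hne]
    rw [he]
    refine ⟨h.write (by simp) _, ?_⟩
    constructor <;> simp [RamState.write, h1, h2, h3, h4, Nat.mod_eq_of_lt hlt]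
  · have hne : m - u = 0 := by omega
    have he : (reduceProg 10 20).exec s =
        ((s.write 5 (m - u)).write 10 (u - m)).write 20 (u * m - m * m) := by
      simp [reduceProg, exec, RamState.write, h.side, h.area, h1, h3, hne]
    have hmod : u % m = u - m := by
      rw [Nat.mod_eq_sub_mod (by omega), Nat.mod_eq_of_lt (by omega)]
    rw [he]
    refine ⟨((h.write (by simp) _).write (by simp) _).write (by simp) _, ?_⟩
    constructor <;> simp [RamState.write, h2, h4, hmod, Nat.sub_mul]

theorem exec_reduceProg_right {u : ℕ} (h : Regs l m a x y v e o s) (hu : u < 2 * m)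
    (h1 : s.reg 10 = z.1) (h2 : s.reg 11 = u) (h3 : s.reg 20 = z.1 * m) (h4 : s.reg 21 = u * m) :
    Regs l m a x y v e o ((reduceProg 11 21).exec s) ∧
      Pos m (z.1, u % m) ((reduceProg 11 21).exec s) := by
  by_cases hlt : u < m
  · have hne : m - u ≠ 0 := by omega
    have he : (reduceProg 11 21).exec s = s.write 5 (m - u) := by
      simp [reduceProg, exec, RamState.write, h.side, h2, hne]
    rw [he]
    refine ⟨h.write (by simp) _, ?_⟩
    constructor <;> simp [RamState.write, h1, h2, h3, h4, Nat.mod_eq_of_lt hlt]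
  · have hne : m - u = 0 := by omega
    have he : (reduceProg 11 21).exec s =
        ((s.write 5 (m - u)).write 11 (u - m)).write 21 (u * m - m * m) := by
      simp [reduceProg, exec, RamState.write, h.side, h.area, h2, h4, hne]
    have hmod : u % m = u - m := by
      rw [Nat.mod_eq_sub_mod (by omega), Nat.mod_eq_of_lt (by omega)]
    rw [he]
    refine ⟨((h.write (by simp) _).write (by simp) _).write (by simp) _, ?_⟩
    constructor <;> simp [RamState.write, h1, h3, hmod, Nat.sub_mul]

theorem exec_genProg (h : Regs l m a x y v e o s) (hz : Pos m z s) (h1 : z.1 < m) (h2 : z.2 < m)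
    (g : Fin 5) :
    Regs l m a x y v e o ((genProg g).exec s) ∧ Pos m (natGen m g z) ((genProg g).exec s) := by
  obtain ⟨p1, p2, p3, p4⟩ := hz
  match g with
  | 0 =>
    have he : (genProg 0).exec s = s := copy_self_exec s
    rw [he]
    exact ⟨h, p1, p2, p3, p4⟩
  | 1 =>
    refine exec_reduceProg_left (z := z) (u := z.1 + z.2)
      (s := (add 20 20 21).exec ((add 10 10 11).exec s))
      ((h.write (by simp) _).write (by simp) _) (by omega) ?_ ?_ ?_ ?_ <;>
    simp [exec, RamState.write, p1, p2, p3, p4, Nat.add_mul]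
  | 2 =>
    refine exec_reduceProg_right (z := z) (u := z.1 + z.2)
      (s := (add 21 20 21).exec ((add 11 10 11).exec s))
      ((h.write (by simp) _).write (by simp) _) (by omega) ?_ ?_ ?_ ?_ <;>
    simp [exec, RamState.write, p1, p2, p3, p4, Nat.add_mul]
  | 3 =>
    refine exec_reduceProg_left (z := z) (u := z.1 + 1)
      (s := (add 20 20 2).exec ((add 10 10 1).exec s))
      ((h.write (by simp) _).write (by simp) _) (by omega) ?_ ?_ ?_ ?_ <;>
    simp [exec, RamState.write, p1, p2, p3, p4, Nat.add_mul, h.one, h.side]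
  | 4 =>
    refine exec_reduceProg_right (z := z) (u := z.2 + 1)
      (s := (add 21 21 2).exec ((add 11 11 1).exec s))
      ((h.write (by simp) _).write (by simp) _) (by omega) ?_ ?_ ?_ ?_ <;>
    simp [exec, RamState.write, p1, p2, p3, p4, Nat.add_mul, h.one, h.side]

/-- Follow a word of generators from the second vertex. -/
def walkProg : List (Fin 5) → RamProgram
  | [] => copy 0 0
  | g :: w => seq (genProg g) (walkProg w)

theorem loopFree_walkProg (w : List (Fin 5)) : (walkProg w).LoopFree := by
  induction w with
  | nil => trivial
  | cons g w ih => exact ⟨loopFree_genProg g, ih⟩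

theorem exec_walkProg (h : Regs l m a x y v e o s) (hz : Pos m z s) (h1 : z.1 < m) (h2 : z.2 < m)
    (w : List (Fin 5)) :
    Regs l m a x y v e o ((walkProg w).exec s) ∧ Pos m (natWalk m w z) ((walkProg w).exec s) := by
  induction w generalizing s z with
  | nil => exact ⟨by rwa [walkProg, copy_self_exec], by rwa [walkProg, copy_self_exec]⟩
  | cons g w ih =>
    obtain ⟨h', hz'⟩ := exec_genProg h hz h1 h2 g
    exact ih h' hz' (natGen_lt h1 h2).1 (natGen_lt h1 h2).2

/-- The number of the right endpoint of the edge that leaves the vertex `v` along the word `w`. -/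
def natTarget (m : ℕ) (w : List (Fin 5)) (v : ℕ) : ℕ :=
  m * m + ((natWalk m w (v / m, v % m)).1 * m + (natWalk m w (v / m, v % m)).2)

/-- Copy the current vertex to the second vertex. -/
def startProg : RamProgram :=
  seq (copy 10 6) (seq (copy 11 7) (seq (sub 20 13 7) (copy 21 22)))

/-- The product (v / m) · m needs no multiplication: it is v minus its remainder. -/
theorem exec_startProg (h : Regs l m a (v / m) (v % m) v e o s) :
    Regs l m a (v / m) (v % m) v e o (startProg.exec s) ∧
      Pos m (v / m, v % m) (startProg.exec s) := by
  have hxm : v - v % m = v / m * m := by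
    have := Nat.div_add_mod' v m
    omega
  refine ⟨(((h.write (by simp) _).write (by simp) _).write (by simp) _).write (by simp) _, ?_⟩
  constructor <;>
    simp [startProg, exec, RamState.write, h.fst, h.snd, h.vertex, h.snd_mul, hxm]

/-- Compute the number of the second vertex on the right side. -/
def targetProg : RamProgram := seq (add 15 14 20) (add 15 15 11)

theorem exec_targetProg (h : Regs l m a x y v e o s) (hz : Pos m z s) :
    Regs l m a x y v e o (targetProg.exec s) ∧
      (targetProg.exec s).reg 15 = m * m + (z.1 * m + z.2) := by
  refine ⟨(h.write (by simp) _).write (by simp) _, ?_⟩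
  simp [targetProg, exec, RamState.write, h.area, hz.fst_mul, hz.snd, Nat.add_assoc]

/-- The program `p` prints the description `f e v w` of the edge number `e` from `v` to `w`. -/
def Emits (p : RamProgram) (f : ℕ → ℕ → ℕ → List ℕ) : Prop :=
  p.LoopFree ∧ ∀ {l m a x y v e : ℕ} {o : List ℕ} {s : RamState},
    Regs l m a x y v e o s → Regs l m a x y v e (o ++ f e v (s.reg 15)) (p.exec s)

/-- Compute the right endpoint of the edge along the word `w`, print a description of the edge
and pass to the next edge. -/
def edgeProg (w : List (Fin 5)) (emit : RamProgram) : RamProgram :=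
  seq startProg (seq (walkProg w) (seq targetProg (seq emit (add 12 12 1))))

theorem loopFree_edgeProg (w : List (Fin 5)) {emit : RamProgram} (h : emit.LoopFree) :
    (edgeProg w emit).LoopFree := by
  simp [edgeProg, startProg, targetProg, LoopFree, loopFree_walkProg, h]

theorem exec_edgeProg {emit : RamProgram} {f : ℕ → ℕ → ℕ → List ℕ} (hf : Emits emit f)
    (w : List (Fin 5)) (hv : v < m * m) (h : Regs l m a (v / m) (v % m) v e o s) :
    Regs l m a (v / m) (v % m) v (e + 1) (o ++ f e v (natTarget m w v))
      ((edgeProg w emit).exec s) := by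
  have hm : 0 < m := Nat.pos_of_ne_zero fun h0 => by simp [h0] at hv
  obtain ⟨h1, p1⟩ := exec_startProg h
  obtain ⟨h2, p2⟩ := exec_walkProg h1 p1 (Nat.div_lt_of_lt_mul hv) (Nat.mod_lt _ hm) w
  obtain ⟨h3, h4⟩ := exec_targetProg h2 p2
  have h5 := hf.2 h3
  rw [h4] at h5
  obtain ⟨r1, r2, r3, r4, r5, r6, r7, r8, r9, r10, r11⟩ := h5
  simp only [edgeProg, exec]
  constructor <;>
    simp [RamState.write, natTarget, r1, r2, r3, r4, r5, r6, r7, r8, r9, r10, r11]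

/-- Process all edges at a left vertex and pass to the next one. -/
def vertexProg (ws : List (List (Fin 5))) (emit : ℕ → RamProgram) : RamProgram :=
  seq (seqList (ws.mapIdx fun i w => edgeProg w (emit i))) <|
    seq (add 13 13 1) <| seq (add 7 7 1) <| seq (add 22 22 2) <| seq (sub 8 8 1) <|
      seq (sub 5 2 7) <| ite 5 (copy 0 0) <| seq (const 7 0) <| seq (const 22 0) (add 6 6 1)

theorem loopFree_vertexProg (ws : List (List (Fin 5))) {emit : ℕ → RamProgram}
    (h : ∀ i, (emit i).LoopFree) : (vertexProg ws emit).LoopFree := by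
  refine ⟨loopFree_seqList fun p hp => ?_, by simp [LoopFree]⟩
  obtain ⟨i, hi, rfl⟩ := List.mem_mapIdx.1 hp
  exact loopFree_edgeProg _ (h i)

/-- What is printed for the edges at a left vertex, if the first one has number `e`. -/
def block (m : ℕ) (ws : List (List (Fin 5))) (f : ℕ → ℕ → ℕ → ℕ → List ℕ) (e v : ℕ) : List ℕ :=
  (List.range ws.length).flatMap fun i => f i (e + i) v (natTarget m (ws.getD i []) v)

/-- Quotient and remainder of the next vertex are obtained by a carry: the remainder is incremented,
and on reaching m it is reset to zero together with its multiple while the quotient grows by one. -/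
theorem exec_vertexProg {ws : List (List (Fin 5))} {emit : ℕ → RamProgram}
    {f : ℕ → ℕ → ℕ → ℕ → List ℕ} (hf : ∀ i, Emits (emit i) (f i)) (hv : v < m * m)
    (h : Regs l m (a + 1) (v / m) (v % m) v e o s) :
    Regs l m a ((v + 1) / m) ((v + 1) % m) (v + 1) (e + ws.length) (o ++ block m ws f e v)
      ((vertexProg ws emit).exec s) := by
  have hm : 0 < m := Nat.pos_of_ne_zero fun h0 => by simp [h0] at hv
  have h1 := exec_seqList (ps := ws.mapIdx fun i w => edgeProg w (emit i))
    (I := fun j s => Regs l m (a + 1) (v / m) (v % m) v (e + j) (o ++ (List.range j).flatMap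
      fun i => f i (e + i) v (natTarget m (ws.getD i []) v)) s)
    (by
      intro j hj s hs
      rw [List.length_mapIdx] at hj
      have := exec_edgeProg (hf j) ws[j] hv hs
      simp only [List.getElem_mapIdx, List.range_succ, List.flatMap_append, List.flatMap_cons,
        List.flatMap_nil, List.append_nil, ← List.append_assoc, List.getD_eq_getElem _ _ hj,
        ← Nat.add_assoc]
      exact this) (by simpa using h)
  rw [List.length_mapIdx, ← block] at h1
  rw [vertexProg, exec]
  set s₁ := (seqList (ws.mapIdx fun i w => edgeProg w (emit i))).exec s
  obtain ⟨r1, r2, r3, r4, r5, r6, r7, r8, r9, r10, r11⟩ := h1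
  have hdm := Nat.div_add_mod' v m
  have hlt := Nat.mod_lt v hm
  by_cases hy : v % m + 1 = m
  · have hd : (v + 1) / m = v / m + 1 := by
      rw [show v + 1 = m * (v / m + 1) by rw [mul_add, mul_one, mul_comm]; omega,
        Nat.mul_div_cancel_left _ hm]
    have hr : (v + 1) % m = 0 := by
      rw [show v + 1 = m * (v / m + 1) by rw [mul_add, mul_one, mul_comm]; omega,
        Nat.mul_mod_right]
    have hz : m - (v % m + 1) = 0 := by omega
    rw [hd, hr]
    constructor <;> simp [exec, RamState.write, *]
  · have hd : (v + 1) / m = v / m := by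
      rw [Nat.div_eq_iff hm]
      constructor <;> omega
    have hr : (v + 1) % m = v % m + 1 := by
      have := Nat.div_add_mod' (v + 1) m
      rw [hd] at this
      omega
    have hz : m - (v % m + 1) ≠ 0 := by omega
    rw [hd, hr]
    constructor <;> simp [exec, RamState.write, *, Nat.add_mul]

end Programs

end Torus

/-! ### Search for the side length, and the complete printing program. -/

namespace Torus

open RamProgram

/-- One less than the side length of the `n`-th torus, the least for which its graph of degree `d`
has at least `n` edges. -/
noncomputable def side (d n : ℕ) : ℕ := sInf {k | n ≤ d * ((k + 1) * (k + 1))}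

theorem le_of_side {d : ℕ} (hd : 0 < d) (n : ℕ) :
    n ≤ d * ((side d n + 1) * (side d n + 1)) := by
  have h : side d n ∈ {k | n ≤ d * ((k + 1) * (k + 1))} :=
    Nat.sInf_mem ⟨n, by
      have : 1 * (1 * n) ≤ d * ((n + 1) * (n + 1)) := by gcongr <;> omega
      simpa using this⟩
  exact h

theorem lt_of_lt_side {d n k : ℕ} (h : k < side d n) : d * ((k + 1) * (k + 1)) < n := by
  simpa using Nat.notMem_of_lt_sInf h

theorem side_le {d : ℕ} (hd : 0 < d) (n : ℕ) : side d n ≤ n := by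
  refine Nat.sInf_le ?_
  have : 1 * (1 * n) ≤ d * ((n + 1) * (n + 1)) := by gcongr <;> omega
  simpa using this

/-- The state of the search for the side length `k + 1`. -/
structure Search (d n k : ℕ) (s : RamState) : Prop where
  input : s.reg 0 = n
  one : s.reg 1 = 1
  side : s.reg 2 = k + 1
  edges : s.reg 3 = d * ((k + 1) * (k + 1))
  edges_step : s.reg 4 = d * (2 * k + 3)
  missing : s.reg 5 = n - d * ((k + 1) * (k + 1))
  area : s.reg 14 = (k + 1) * (k + 1)
  two_mul : s.reg 16 = 2 * d
  area_step : s.reg 17 = 2 * k + 3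
  two : s.reg 19 = 2
  out : s.out = []

/-- Start the search for the side length. -/
def initProg (d : ℕ) : RamProgram :=
  seq (const 1 1) <| seq (const 2 1) <| seq (const 3 d) <| seq (const 4 (d * 3)) <|
    seq (const 16 (2 * d)) <| seq (const 14 1) <| seq (const 17 3) <| seq (const 19 2) (sub 5 0 3)

/-- Try the next side length. -/
def stepProg : RamProgram :=
  seq (add 3 3 4) <| seq (add 4 4 16) <| seq (add 14 14 17) <| seq (add 17 17 19) <|
    seq (add 2 2 1) (sub 5 0 3)

/-- Move to the first vertex. -/
def finishProg : RamProgram :=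
  seq (const 6 0) <| seq (const 7 0) <| seq (copy 8 14) <| seq (const 12 0) <|
    seq (const 13 0) (const 22 0)

theorem exec_initProg (d n : ℕ) : Search d n 0 ((initProg d).exec (RamState.init n)) := by
  constructor <;> simp [initProg, exec, RamState.write, RamState.init]

/-- Consecutive squares (k + 1)² and (k + 2)² differ by 2k + 3, so the area and its multiple by d
are updated by additions. -/
theorem exec_stepProg {d n k : ℕ} {s : RamState} (h : Search d n k s) :
    Search d n (k + 1) (stepProg.exec s) := by
  obtain ⟨r0, r1, r2, r3, r4, r5, r6, r7, r8, r9, r10⟩ := h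
  have e1 : d * ((k + 1) * (k + 1)) + d * (2 * k + 3) = d * ((k + 1 + 1) * (k + 1 + 1)) := by ring
  have e2 : d * (2 * k + 3) + 2 * d = d * (2 * (k + 1) + 3) := by ring
  have e3 : (k + 1) * (k + 1) + (2 * k + 3) = (k + 1 + 1) * (k + 1 + 1) := by ring
  have e4 : 2 * k + 3 + 2 = 2 * (k + 1) + 3 := by ring
  constructor <;>
    simp only [stepProg, exec, RamState.write, ne_eq, Nat.reduceEqDiff,
      OfNat.one_ne_ofNat, OfNat.zero_ne_ofNat,
      not_false_eq_true, Function.update_self, Function.update_of_ne, r0, r1, r2, r3, r4, r6, r7,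
      r8, r9, r10, e1, e2, e3, e4]

theorem exec_finishProg {d n k : ℕ} {s : RamState} (h : Search d n k s) :
    Regs (d * ((k + 1) * (k + 1))) (k + 1) ((k + 1) * (k + 1)) 0 0 0 0 [] (finishProg.exec s) := by
  obtain ⟨r0, r1, r2, r3, r4, r5, r6, r7, r8, r9, r10⟩ := h
  constructor <;> simp [finishProg, exec, RamState.write, r1, r2, r3, r6, r10]

/-- The program `p` prints the list `g N l` if there are `2 * N` vertices and `l` edges. -/
def Announces (p : RamProgram) (g : ℕ → ℕ → List ℕ) : Prop :=
  p.LoopFree ∧ ∀ {l m a x y v e : ℕ} {o : List ℕ} {s : RamState},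
    Regs l m a x y v e o s → Regs l m a x y v e (o ++ g (m * m) l) (p.exec s)

/-- Print a description of the graph, edge by edge. -/
def graphProg (ws : List (List (Fin 5))) (header : RamProgram) (emit : ℕ → RamProgram) :
    RamProgram :=
  seq (initProg ws.length) <| seq (loop 5 stepProg) <| seq (seq finishProg header) <|
    loop 8 (vertexProg ws emit)

/-- What is printed for the torus of side length `m`. -/
def description (m : ℕ) (ws : List (List (Fin 5))) (g : ℕ → ℕ → List ℕ)
    (f : ℕ → ℕ → ℕ → ℕ → List ℕ) : List ℕ :=
  g (m * m) (ws.length * (m * m)) ++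
    (List.range (m * m)).flatMap fun v => block m ws f (v * ws.length) v

theorem exists_run_graphProg {ws : List (List (Fin 5))} (hws : 0 < ws.length)
    {header : RamProgram} {g : ℕ → ℕ → List ℕ} (hg : Announces header g)
    {emit : ℕ → RamProgram} {f : ℕ → ℕ → ℕ → ℕ → List ℕ} (hf : ∀ i, Emits (emit i) (f i))
    (n : ℕ) :
    ∃ t s, RamRun (graphProg ws header emit) (RamState.init n) t s ∧
      t ≤ (initProg ws.length).cost + (seq finishProg header).cost +
        (stepProg.cost + (vertexProg ws emit).cost + 2) * (n + 2) ^ 2 ∧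
      s.out = description (side ws.length n + 1) ws g f := by
  set d := ws.length with hd
  set k := side d n with hk
  obtain ⟨t₁, ht₁, h₁⟩ := LoopFree.exists_run (p := initProg d) (by simp [initProg, LoopFree])
    (RamState.init n)
  -- With j iterations left the candidate side is k - j + 1. Minimality of k keeps the truncated
  -- difference in register 5 positive until j = 0, where it vanishes.
  obtain ⟨t₂, ht₂, s₂, h₂, -, hs₂⟩ := LoopFree.exists_run_loop (p := stepProg) (i := 5)
    (by simp [stepProg, LoopFree]) (I := fun j s => j ≤ k ∧ Search d n (k - j) s)
    (by
      rintro s ⟨-, hs⟩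
      rw [hs.missing]
      exact Nat.sub_eq_zero_of_le (le_of_side hws n))
    (by
      rintro j s ⟨hj, hs⟩
      have hlt : k - (j + 1) < k := by omega
      refine ⟨?_, by omega, ?_⟩
      · rw [hs.missing]
        have := lt_of_lt_side hlt
        omega
      · have := exec_stepProg hs
        rwa [show k - (j + 1) + 1 = k - j by omega] at this)
    (j := k) (s := (initProg d).exec (RamState.init n))
    ⟨le_rfl, by rw [Nat.sub_self]; exact exec_initProg d n⟩
  rw [Nat.sub_zero] at hs₂
  obtain ⟨t₃, ht₃, h₃⟩ := LoopFree.exists_run (p := seq finishProg header)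
    ⟨by simp [finishProg, LoopFree], hg.1⟩ s₂
  have hs₃ := hg.2 (exec_finishProg hs₂)
  rw [List.nil_append] at hs₃
  set m := k + 1 with hm
  -- With j vertices left the current one is m² - j, and its first edge has number (m² - j)·d.
  obtain ⟨t₄, ht₄, s₄, h₄, -, hs₄⟩ := LoopFree.exists_run_loop (p := vertexProg ws emit) (i := 8)
    (loopFree_vertexProg ws fun i => (hf i).1)
    (I := fun j s => j ≤ m * m ∧ Regs (d * (m * m)) m j ((m * m - j) / m) ((m * m - j) % m)
      (m * m - j) ((m * m - j) * d) (g (m * m) (d * (m * m)) ++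
        (List.range (m * m - j)).flatMap fun v => block m ws f (v * d) v) s)
    (fun s hs => hs.2.count)
    (by
      rintro j s ⟨hj, hs⟩
      refine ⟨by rw [hs.count]; omega, by omega, ?_⟩
      have := exec_vertexProg (ws := ws) hf (by omega) hs
      have e1 : m * m - (j + 1) + 1 = m * m - j := by omega
      rw [← hd, ← Nat.succ_mul, Nat.succ_eq_add_one, e1, List.append_assoc] at this
      rw [← e1, List.range_succ, List.flatMap_append, List.flatMap_singleton, e1]
      exact this)
    (j := m * m) (s := (seq finishProg header).exec s₂)
    ⟨le_rfl, by simpa [exec] using hs₃⟩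
  refine ⟨_, s₄, .seq h₁ (.seq h₂ (.seq h₃ h₄)), ?_, ?_⟩
  · have hkn : k ≤ n := side_le hws n
    have hmm : m * m ≤ (n + 2) ^ 2 := by
      rw [sq]
      exact Nat.mul_le_mul (by omega) (by omega)
    have hkk : k + 2 ≤ (n + 2) ^ 2 := by nlinarith
    have h1 := Nat.mul_le_mul_right stepProg.cost (show k ≤ (n + 2) ^ 2 by omega)
    have h2 := Nat.mul_le_mul_right (vertexProg ws emit).cost hmm
    linarith
  · rw [hs₄.out, Nat.sub_zero, description]

/-- A family of descriptions is printed by one program in polynomial time. -/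
theorem exists_program {ws : List (List (Fin 5))} (hws : 0 < ws.length)
    {header : RamProgram} {g : ℕ → ℕ → List ℕ} (hg : Announces header g)
    {emit : ℕ → RamProgram} {f : ℕ → ℕ → ℕ → ℕ → List ℕ} (hf : ∀ i, Emits (emit i) (f i))
    {IsCode : ℕ → List ℕ → Prop}
    (h : ∀ n, IsCode n (description (side ws.length n + 1) ws g f)) :
    HasExplicitConstruction IsCode := by
  refine ⟨graphProg ws header emit,
    Polynomial.C ((initProg ws.length).cost + (seq finishProg header).cost) +
      Polynomial.C (stepProg.cost + (vertexProg ws emit).cost + 2) * (Polynomial.X + 2) ^ 2,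
    fun n => ?_⟩
  obtain ⟨t, s, hr, ht, hs⟩ := exists_run_graphProg hws hg hf n
  refine ⟨t, s, hr, ?_, hs ▸ h n⟩
  simpa using ht

/-! ### Printing the outer graph -/

theorem announces_graph : Announces (seq (add 5 14 14) (seq (print 5) (print 3)))
    fun N l => [N + N, l] := by
  refine ⟨by simp [LoopFree], fun h => ?_⟩
  obtain ⟨r1, r2, r3, r4, r5, r6, r7, r8, r9, r10, r11⟩ := h
  constructor <;> simp [exec, RamState.write, *]

theorem emits_graph : Emits (seq (print 13) (print 15)) fun _ v w => [v, w] := by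
  refine ⟨by simp [LoopFree], fun h => ?_⟩
  obtain ⟨r1, r2, r3, r4, r5, r6, r7, r8, r9, r10, r11⟩ := h
  constructor <;> simp [exec, *]

/-! ### Printing the routed product -/

theorem announces_product (r : ℕ) :
    Announces (seq (add 15 14 14) (seq (mulConst 18 15 r) (seq (print 3) (print 18))))
      fun N l => [l, r * (N + N)] := by
  refine ⟨by simp [LoopFree, loopFree_mulConst], fun h => ?_⟩
  obtain ⟨r1, r2, r3, r4, r5, r6, r7, r8, r9, r10, r11⟩ := h
  simp only [exec, exec_mulConst (show 18 ≠ 15 by decide)]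
  constructor <;> simp [RamState.write, *]

/-- Print the edges from the current left vertex to the right vertices with numbers `j + c`, where
`c` is the contents of register `18`. -/
def printProg (js : List ℕ) : RamProgram :=
  seqList (js.map fun j => seq (const 5 j) (seq (add 5 5 18) (seq (print 12) (print 5))))

theorem loopFree_printProg (js : List ℕ) : (printProg js).LoopFree := by
  refine loopFree_seqList fun p hp => ?_
  obtain ⟨j, _, rfl⟩ := List.mem_map.1 hp
  simp [LoopFree]

theorem exec_printProg {l m a x y v e c w : ℕ} {o : List ℕ} {s : RamState}
    (h : Regs l m a x y v e o s) (hc : s.reg 18 = c) (hw : s.reg 15 = w) (js : List ℕ) :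
    Regs l m a x y v e (o ++ js.flatMap fun j => [e, j + c]) ((printProg js).exec s) ∧
      ((printProg js).exec s).reg 15 = w := by
  induction js generalizing o s with
  | nil =>
    rw [printProg, List.map_nil, exec_seqList_nil]
    exact ⟨by simpa using h, hw⟩
  | cons j js ih =>
    have h' : Regs l m a x y v e (o ++ [e, j + c])
        ((seq (const 5 j) (seq (add 5 5 18) (seq (print 12) (print 5)))).exec s) := by
      obtain ⟨r1, r2, r3, r4, r5, r6, r7, r8, r9, r10, r11⟩ := h
      constructor <;> simp [exec, RamState.write, *]
    have := ih h' (by simpa [exec, RamState.write] using hc)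
      (by simpa [exec, RamState.write] using hw)
    rw [List.append_assoc] at this
    exact this

/-- Print the edges of the routed product at the current left vertex. -/
def productProg (r : ℕ) (js : List ℕ) : RamProgram :=
  seq (mulConst 18 13 r) <| seq (printProg js) <| seq (mulConst 18 15 r) (printProg js)

/-- The right vertex (p, j) has number j + r·p. The neighbors above the two endpoints are printed in
two passes; the second reads register 15, which the first must preserve. -/
theorem emits_product (r : ℕ) (js : List ℕ) :
    Emits (productProg r js) fun e v w =>
      (js.flatMap fun j => [e, j + r * v]) ++ js.flatMap fun j => [e, j + r * w] := by
  refine ⟨by simp [productProg, LoopFree, loopFree_mulConst, loopFree_printProg], ?_⟩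
  intro l m a x y v e o s h
  simp only [productProg, exec, exec_mulConst (show 18 ≠ 13 by decide),
    exec_mulConst (show 18 ≠ 15 by decide), h.vertex]
  obtain ⟨h1, w1⟩ := exec_printProg (c := r * v) (w := s.reg 15)
    (h.write (i := 18) (by simp) (r * v)) (by simp [RamState.write]) (by simp [RamState.write]) js
  rw [w1, ← List.append_assoc]
  exact (exec_printProg (c := r * s.reg 15) (w := s.reg 15)
    (h1.write (i := 18) (by simp) (r * s.reg 15)) (by simp [RamState.write])
    (by simpa [RamState.write] using w1) js).1

end Torus

/-! ### The printed lists describe the graphs -/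

/-- Matches the flat numbering of edges with the nested loops of the program, over vertices and then
over words. -/
theorem List.flatMap_finRange_mul {α : Type*} (N d : ℕ) (F : Fin (N * d) → List α) :
    (List.finRange (N * d)).flatMap F = (List.finRange N).flatMap fun v =>
      (List.finRange d).flatMap fun i => F (finProdFinEquiv (v, i)) := by
  have h : List.finRange (N * d) = (List.finRange N).flatMap fun v =>
      (List.finRange d).map fun i => finProdFinEquiv (v, i) := by
    rw [← List.ofFn_id, List.ofFn_mul, List.flatMap, ← List.ofFn_eq_map]
    congr 2
    funext v
    rw [← List.ofFn_eq_map]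
    congr 1
    funext i
    apply Fin.ext
    simp [finProdFinEquiv, mul_comm, add_comm]
  rw [h, List.flatMap_assoc]
  simp only [List.flatMap_map]

theorem List.flatMap_range_eq {α : Type*} (N : ℕ) (F : ℕ → List α) :
    (List.range N).flatMap F = List.flatMap (fun v : Fin N => F v) (List.finRange N) := by
  rw [← List.map_coe_finRange_eq_range, List.flatMap_map]

namespace Torus

open RamProgram PermGraph

theorem natGen_val (k : ℕ) (g : Fin 5) (z : ZMod (k + 1) × ZMod (k + 1)) :
    natGen (k + 1) g (z.1.val, z.2.val) = ((gen (k + 1) g z).1.val, (gen (k + 1) g z).2.val) := by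
  match g with
  | 0 => rfl
  | 1 => simp only [natGen, gen, Equiv.coe_fn_mk, ZMod.val_add]
  | 2 => simp only [natGen, gen, Equiv.coe_fn_mk, ZMod.val_add]
  | 3 => simp only [natGen, gen, Equiv.coe_fn_mk, ZMod.val_add, ZMod.val_one_eq_one_mod,
      Nat.add_mod_mod]
  | 4 => simp only [natGen, gen, Equiv.coe_fn_mk, ZMod.val_add, ZMod.val_one_eq_one_mod,
      Nat.add_mod_mod]

theorem natWalk_val (k : ℕ) (w : List (Fin 5)) (z : ZMod (k + 1) × ZMod (k + 1)) :
    natWalk (k + 1) w (z.1.val, z.2.val) =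
      ((walk (k + 1) w z).1.val, (walk (k + 1) w z).2.val) := by
  induction w generalizing z with
  | nil => rfl
  | cons g w ih =>
    rw [natWalk, natGen_val, ih]
    rfl

theorem index_val (k : ℕ) (z : ZMod (k + 1) × ZMod (k + 1)) :
    (index k z : ℕ) = z.1.val * (k + 1) + z.2.val := by
  change z.2.val + (k + 1) * z.1.val = _
  rw [mul_comm, add_comm]

theorem index_symm_val (k : ℕ) (v : Fin ((k + 1) * (k + 1))) :
    ((v : ℕ) / (k + 1), (v : ℕ) % (k + 1)) =
      (((index k).symm v).1.val, ((index k).symm v).2.val) :=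
  rfl

theorem natTarget_eq (k t : ℕ) (v : Fin ((k + 1) * (k + 1))) (i : Fin (words t).length) :
    natTarget (k + 1) ((words t).getD i []) v =
      (Fin.natAdd ((k + 1) * (k + 1)) (wordPerm k t i v) : ℕ) := by
  rw [natTarget, index_symm_val, natWalk_val, Fin.val_natAdd, wordPerm, Equiv.trans_apply,
    Equiv.trans_apply, index_val, List.getD_eq_getElem _ _ i.2]
  rfl

/-- The printed list, in terms of the edges of the graph. -/
theorem description_eq (k t : ℕ) (g : ℕ → ℕ → List ℕ) (f : ℕ → ℕ → ℕ → ℕ → List ℕ) :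
    description (k + 1) (words t) g f =
      g ((k + 1) * (k + 1)) ((k + 1) * (k + 1) * (words t).length) ++
        List.flatMap (fun e : Fin ((k + 1) * (k + 1) * (words t).length) =>
          f e.modNat e (lft e) (rgt (wordPerm k t) e)) (List.finRange _) := by
  rw [description, mul_comm (words t).length, List.flatMap_finRange_mul, List.flatMap_range_eq]
  congr 2
  funext v
  rw [block, List.flatMap_range_eq]
  congr 1
  funext i
  have h := finProdFinEquiv.symm_apply_apply (v, i)
  rw [finProdFinEquiv_symm_apply, Prod.mk.injEq] at h
  rw [natTarget_eq, lft, rgt, h.1, h.2, Fin.val_castAdd, finProdFinEquiv_apply_val, add_comm,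
    mul_comm]

theorem isWrittenAs_graph (k t : ℕ) :
    (graph (wordPerm k t)).IsWrittenAs
      (description (k + 1) (words t) (fun N l => [N + N, l]) fun _ _ v w => [v, w]) := by
  refine ⟨fun e => (lft e, rgt (wordPerm k t) e), fun e => rfl, ?_⟩
  rw [description_eq, List.ofFn_eq_map, List.flatMap_map]
  rfl

/-- The routed product with numbered right vertices. -/
noncomputable def numberedProduct {N d r : ℕ} (π : Fin d → Equiv.Perm (Fin N))
    (G' : BipartiteGraph (Fin d) (Fin r)) : BipartiteGraph (Fin (N * d)) (Fin ((N + N) * r)) :=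
  (product π G').mapRight finProdFinEquiv

theorem mem_numberedProduct_nbr {N d r : ℕ} (π : Fin d → Equiv.Perm (Fin N))
    (G' : BipartiteGraph (Fin d) (Fin r)) (e : Fin (N * d)) (q : Fin ((N + N) * r)) :
    q ∈ (numberedProduct π G').nbr e ↔ ∃ j ∈ G'.nbr e.modNat,
      finProdFinEquiv (lft e, j) = q ∨ finProdFinEquiv (rgt π e, j) = q := by
  obtain ⟨⟨p, j⟩, rfl⟩ := finProdFinEquiv.surjective q
  simp only [numberedProduct, BipartiteGraph.mapRight, Finset.mem_map_equiv,
    Equiv.symm_apply_apply, mem_product_nbr, EmbeddingLike.apply_eq_iff_eq, Prod.mk.injEq]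
  constructor
  · rintro ⟨h | h, hj⟩
    · exact ⟨j, hj, Or.inl ⟨h.symm, rfl⟩⟩
    · exact ⟨j, hj, Or.inr ⟨h.symm, rfl⟩⟩
  · rintro ⟨j', hj, ⟨h, rfl⟩ | ⟨h, rfl⟩⟩
    · exact ⟨Or.inl h.symm, hj⟩
    · exact ⟨Or.inr h.symm, hj⟩

/-- The numbers of the neighbors of the `i`-th vertex of the inner graph. -/
noncomputable def nbrList {d r : ℕ} (G' : BipartiteGraph (Fin d) (Fin r)) (i : ℕ) : List ℕ :=
  if h : i < d then (G'.nbr ⟨i, h⟩).toList.map Fin.val else []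

theorem isWrittenAs_numberedProduct (k t : ℕ) {r : ℕ}
    (G' : BipartiteGraph (Fin (words t).length) (Fin r)) :
    (numberedProduct (wordPerm k t) G').IsWrittenAs
      (description (k + 1) (words t) (fun N l => [l, r * (N + N)]) fun i e v w =>
        ((nbrList G' i).flatMap fun j => [e, j + r * v]) ++
          (nbrList G' i).flatMap fun j => [e, j + r * w]) := by
  refine ⟨(List.finRange _).flatMap fun e =>
    ((G'.nbr e.modNat).toList.map fun j => (e, finProdFinEquiv (lft e, j))) ++
      (G'.nbr e.modNat).toList.map fun j => (e, finProdFinEquiv (rgt (wordPerm k t) e, j)),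
    fun e q => ?_, ?_⟩
  · rw [mem_numberedProduct_nbr]
    simp only [List.mem_flatMap, List.mem_finRange, true_and, List.mem_append, List.mem_map,
      Finset.mem_toList, Prod.mk.injEq]
    constructor
    · rintro ⟨e', ⟨j, hj, rfl, h⟩ | ⟨j, hj, rfl, h⟩⟩
      · exact ⟨j, hj, Or.inl h⟩
      · exact ⟨j, hj, Or.inr h⟩
    · rintro ⟨j, hj, h | h⟩
      · exact ⟨e, Or.inl ⟨j, hj, rfl, h⟩⟩
      · exact ⟨e, Or.inr ⟨j, hj, rfl, h⟩⟩
  · have hn : ∀ i : Fin (words t).length, nbrList G' i = (G'.nbr i).toList.map Fin.val :=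
      fun i => dif_pos i.2
    simp only [description_eq, hn, List.flatMap_assoc, List.flatMap_append, List.flatMap_map,
      finProdFinEquiv_apply_val, mul_comm r ((k + 1) * (k + 1) + (k + 1) * (k + 1))]
    rfl

theorem explicit_graph (t : ℕ) :
    HasExplicitConstruction fun n out =>
      (graph (wordPerm (side (words t).length n) t)).IsWrittenAs out :=
  exists_program (by rw [length_words]; positivity) announces_graph (fun _ => emits_graph)
    fun _ => isWrittenAs_graph _ t

theorem explicit_numberedProduct (t : ℕ) {r : ℕ}
    (G' : BipartiteGraph (Fin (words t).length) (Fin r)) :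
    HasExplicitConstruction fun n out =>
      (numberedProduct (wordPerm (side (words t).length n) t) G').IsWrittenAs out :=
  exists_program (by rw [length_words]; positivity) (announces_product r)
    (fun i => emits_product r (nbrList G' i)) fun _ => isWrittenAs_numberedProduct _ t G'

/-- Long words give permutations of small second eigenvalue. -/
theorem exists_forall_isContracting {δ : ℝ} (hδ : 0 < δ) (D : ℕ) :
    ∃ t, D ≤ (words t).length ∧
      ∀ k, IsContracting (wordPerm k t) ((δ / 4 * (words t).length) ^ 2) := by
  -- Since 25 - 1/400 = (1 - 1/10000)·5², the contraction relative to the squared degree is a power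
  -- of 1 - 1/10000. Adding D to the length makes 5^t exceed D without weakening it.
  obtain ⟨t₀, ht₀⟩ := exists_pow_lt_of_lt_one (show 0 < (δ / 4) ^ 2 by positivity)
    (show (1 - 1 / 10000 : ℝ) < 1 by norm_num)
  refine ⟨t₀ + D, ?_, fun k f hf => ?_⟩
  · rw [length_words]
    exact (Nat.le_add_left D t₀).trans (Nat.lt_pow_self (by norm_num)).le
  · refine (isContracting_wordPerm k (t₀ + D) f hf).trans ?_
    refine mul_le_mul_of_nonneg_right ?_ (Finset.sum_nonneg fun _ _ => sq_nonneg _)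
    rw [length_words, mul_pow]
    push_cast
    rw [← pow_mul, mul_comm (t₀ + D) 2, pow_mul, show (25 - 1 / 400 : ℝ) =
      (1 - 1 / 10000) * 5 ^ 2 by norm_num, mul_pow]
    refine mul_le_mul_of_nonneg_right (le_trans ?_ ht₀.le) (by positivity)
    exact pow_le_pow_of_le_one (by norm_num) (by norm_num) (Nat.le_add_right _ _)

/-- Rounding up to a full torus costs a bounded factor: by minimality the previous side k + 1 has
d(k + 1)² < n, and (k + 2)² ≤ 4(k + 1)². This 4 and the two sides of the outer graph use up the
factor 8 in `hr`; n > d guarantees that a previous side exists. -/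
theorem eventually_card_right_le {β : ℝ} (hβ : 0 ≤ β) {d r : ℕ} (hd : 0 < d) (hr : 8 * (r : ℝ) ≤ β * d) :
    ∀ᶠ n : ℕ in Filter.atTop, ((((side d n + 1) * (side d n + 1) +
      (side d n + 1) * (side d n + 1)) * r : ℕ) : ℝ) ≤ β * n := by
  filter_upwards [Filter.eventually_gt_atTop d] with n hn
  have h0 : side d n ≠ 0 := by
    intro h0
    have := le_of_side hd n
    rw [h0] at this
    omega
  obtain ⟨k, hk⟩ := Nat.exists_eq_succ_of_ne_zero h0
  have h1 := lt_of_lt_side (show k < side d n by omega)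
  rw [hk, Nat.succ_eq_add_one]
  have h2 : (d : ℝ) * ((k + 1) * (k + 1)) ≤ n := by exact_mod_cast h1.le
  have h3 : (((k + 1 + 1) * (k + 1 + 1) + (k + 1 + 1) * (k + 1 + 1) : ℕ) : ℝ) ≤
      8 * ((k + 1) * (k + 1)) := by
    push_cast
    nlinarith [Nat.cast_nonneg (α := ℝ) k]
  rw [Nat.cast_mul]
  calc (((k + 1 + 1) * (k + 1 + 1) + (k + 1 + 1) * (k + 1 + 1) : ℕ) : ℝ) * r
      ≤ 8 * ((k + 1) * (k + 1)) * r := by gcongr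
    _ = ((k + 1) * (k + 1)) * (8 * r) := by ring
    _ ≤ ((k + 1) * (k + 1)) * (β * d) := by gcongr
    _ = β * (d * ((k + 1) * (k + 1))) := by ring
    _ ≤ β * n := by gcongr

end Torus

/-! ### Assembly of the family. -/

theorem theorem3p5 (β : ℝ) (hβ₀ : 0 < β) (hβ₁ : β ≤ 1) :
    ∃ (δ α : ℝ) (c : ℕ), 0 < δ ∧ 0 < α ∧ 0 < c ∧
      ∃ (l r : ℕ → ℕ) (H : ∀ n : ℕ, BipartiteGraph (Fin (l n)) (Fin (r n))),
        HasExplicitConstruction (fun n out => (H n).IsWrittenAs out) ∧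
        (∀ n : ℕ, n ≤ l n ∧ (H n).IsLeftRegular c ∧ (H n).IsUnbalanced β ∧
          (H n).IsUNExpander c δ α) ∧
        (∀ᶠ n : ℕ in Filter.atTop, (r n : ℝ) ≤ β * n) ∧
        -- `H n` is the routed product of the incidence graph of `G n` with `G'`
        ∃ (d r' c' : ℕ) (δ' : ℝ) (G' : BipartiteGraph (Fin d) (Fin r'))
          (k : ℕ → ℕ) (G : ∀ n : ℕ, LooplessGraph (Fin (k n)) (Fin (l n))),
          0 < δ' ∧ G'.IsUNExpander c' δ' (1 / 2) ∧
          HasExplicitConstruction (fun n out => (G n).IsWrittenAs out) ∧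
          ∀ n : ℕ, (G n).IsSpectralExpander d (δ' / 4 * d) ∧
            ∃ (ord : ∀ v : Fin (k n), Fin d ≃ {e // v ∈ (G n).incidenceGraph.nbr e})
              (f : Fin (k n) × Fin r' ≃ Fin (r n)),
              ∀ e : Fin (l n), (H n).nbr e =
                (((G n).incidenceGraph.routedProduct ord G').nbr e).map f.toEmbedding := by
  -- The order of choices avoids circularity: δ depends on β only, the word length t on δ and D, and
  -- the inner graph is taken last, on the resulting degree 5^t ≥ D.
  obtain ⟨δ, hδ, hδ₁, D, hD⟩ := RandomGraph.exists_isUNExpander hβ₀ hβ₁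
  obtain ⟨t, ht, hπ⟩ := Torus.exists_forall_isContracting hδ D
  obtain ⟨r, hr, G', hG'⟩ := hD _ ht
  have hd : 0 < (Torus.words t).length := by
    rw [Torus.length_words]
    positivity
  have : NeZero (Torus.words t).length := ⟨hd.ne'⟩
  have hd' : (0 : ℝ) < (Torus.words t).length := by exact_mod_cast hd
  let k : ℕ → ℕ := Torus.side (Torus.words t).length
  have hH : ∀ n, (Torus.numberedProduct (Torus.wordPerm (k n) t) G').IsUNExpander (2 * 8)
      (δ ^ 2 / 4) (1 / 6) := fun n =>
    BipartiteGraph.isUNExpander_mapRight (PermGraph.product_isUNExpander hδ hG' (hπ (k n))) _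
  refine ⟨δ ^ 2 / 4, 1 / 6, 2 * 8, by positivity, by norm_num, by norm_num, _, _,
    fun n => Torus.numberedProduct (Torus.wordPerm (k n) t) G',
    Torus.explicit_numberedProduct t G', fun n => ⟨?_, (hH n).1, ?_, hH n⟩,
    Torus.eventually_card_right_le hβ₀.le hd hr, (Torus.words t).length, r, 8, δ, G', _,
    fun n => PermGraph.graph (Torus.wordPerm (k n) t), hδ, hG', Torus.explicit_graph t,
    fun n => ⟨?_, PermGraph.ord _, finProdFinEquiv, fun e => rfl⟩⟩
  · rw [mul_comm]
    exact Torus.le_of_side hd n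
  · rw [BipartiteGraph.IsUnbalanced, Fintype.card_fin, Fintype.card_fin]
    push_cast
    have := mul_le_mul_of_nonneg_left hr
      (show (0 : ℝ) ≤ ((k n : ℝ) + 1) * ((k n : ℝ) + 1) by positivity)
    nlinarith
  -- The eigenvalue bound δd/4 is below d because δ ≤ 1; this is what makes the top eigenvalue
  -- simple.
  · exact PermGraph.isSpectralExpander (by positivity) (by nlinarith) (hπ (k n))
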